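/- **Setting.** Let $L>0$ and $\mathcal Z=\mathbb Z^2\setminus\{0\}$. For $k\in\mathcal Z$ let $\mu_k=(2\pi|k|/L)^2$ and $e_k(x)=\omega_{k_1}(x_1)\,\omega_{k_2}(x_2)$, $x\in[0,L]^2$, where $\omega_m(z)=\sqrt{2/L}\,\sin(2\pi m z/L)$ for $m>0$, $\omega_0(z)=1/\sqrt L$, and $\omega_m(z)=\sqrt{2/L}\,\cos(2\pi m z/L)$ for $m<0$. For $a\in\mathbb R$ let $\mathcal H^a$ be the space of (formal) series $u=\sum_{k\in\mathcal Z}u_ke_k$ with real coefficients and $\|u\|_{\mathcal H^a}^2=\sum_k\mu_k^a u_k^2<\infty$. Let $e^{tA}u=\sum_k e^{-t\mu_k^2}u_ke_k$ be the semigroup generated by $A=-\Delta^2$. For $u\in\mathcal H^1$ let $\nabla u=\sum_k u_k\nabla e_k$ in $L^2([0,L]^2,\mathbb R^2)$, and let $$\mathfrak F(u)=\nabla\cdot\frac{\nabla u}{1+|\nabla u|^2}\in\mathcal H^{-1},$$ the divergence of $g\in L^2([0,L]^2,\mathbb R^2)$ being the element of $\mathcal H^{-1}$ with coefficients $-\int_{[0,L]^2}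 g\cdot\nabla e_k\,dx$. **Noise.** Let $(\beta_k)_{k\in\mathcal Z}$ be independent standard real Brownian motions on a probability space $(\Omega,\mathbb P)$. For $\varepsilon>0$ let $\alpha^{(\varepsilon)}=(\alpha^{(\varepsilon)}_k)_{k\in\mathcal Z}$ be real, bounded uniformly in $k$ and $\varepsilon$, dependent on $k$ only through $|k|$, with $\alpha_k^{(\varepsilon)}=\mathcal O(|k|^{-\delta(\varepsilon)})$ for some $\delta(\varepsilon)>0$ and each $\varepsilon$, and with $\alpha_k^{(\varepsilon)}\to1$ as $\varepsilon\to0$ for each $k$. Let $$Z_\varepsilon(t)=\sum_{k\in\mathcal Z}\alpha_k^{(\varepsilon)}\int_0^te^{-(t-s)\mu_k^2}\,d\beta_k(s)\;e_k ,$$ where the integrals are Wiener integrals and the series converges in $L^2(\Omega;\mathcal H^1)$. **Mild solutions.** Let $u_0\in\mathcal H^1$, $T>0$, $\sigma\in\mathbb R$ and $\kappa\in\{1,-1\}$. A mild solution on $[0,T]$ of $$\partial_tu=-\Delta^2u+\kappa\,\nabla\cdot\frac{\nabla u}{1+|\nabla u|^2}+\sigma\,\partial_tW_\varepsilon,\qquad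 u(0)=u_0,\qquad W_\varepsilon=\sum_{k\in\mathcal Z}\alpha^{(\varepsilon)}_k\beta_ke_k,$$ is an $\mathcal H^1$-valued process $u_\varepsilon$ with almost surely continuous paths in $\mathcal H^1$ such that for every $t\in[0,T]$, almost surely, $$u_\varepsilon(t)=e^{tA}u_0+\kappa\int_0^te^{(t-s)A}\mathfrak F(u_\varepsilon(s))\,ds+\sigma Z_\varepsilon(t),$$ with a Bochner integral in $\mathcal H^1$. **Theorem.** For all $\varepsilon>0$, $u_0\in\mathcal H^1$, $T>0$, $\sigma\in\mathbb R$ and $\kappa\in\{1,-1\}$: 1. $Z_\varepsilon$ has a version on $[0,T]$ with almost surely continuous paths in $\mathcal H^1$. 2. For every $v\in C([0,T],\mathcal H^1)$ and $t\in[0,T]$ the function $s\mapsto e^{(t-s)A}\mathfrak F(v(s))$ is Bochner integrable on $[0,t]$ in $\mathcal H^1$, and for every $z\in C([0,T],\mathcal H^1)$ the path $\mathfrak G_z(v)(t)=e^{tA}u_0+\kappa\int_0^te^{(t-s)A}\mathfrak F(v(s))\,ds+\sigma z(t)$ belongs to $C([0,T],\mathcal H^1)$. 3. There is a mild solution $u_\varepsilon$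 on $[0,T]$, with measurable values $u_\varepsilon(t)$ and with all paths continuous in $\mathcal H^1$, and every mild solution on $[0,T]$ is indistinguishable from it. 4. For every version of $Z_\varepsilon$ with almost surely continuous paths in $\mathcal H^1$, for almost every $\omega$ the path $u_\varepsilon(\cdot,\omega)$ is the unique fixed point in $C([0,T],\mathcal H^1)$ of the variation-of-constants map $\mathfrak G_{Z_\varepsilon(\cdot,\omega)}$. -/

import Mathlib

open MeasureTheory ProbabilityTheory Filter Topology Set
open scoped NNReal ENNReal

noncomputable section

namespace SurfaceGrowth

/-! ## Fourier modes on the square -/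

/-- Wave numbers: the nonzero elements of the lattice of pairs of integers. -/
abbrev Mode : Type := {k : Fin 2 → ℤ // k ≠ 0}

/-- Points of the square. -/
abbrev Point : Type := Fin 2 → ℝ

/-- Two-dimensional Euclidean vectors, the values of gradients. -/
abbrev Vec : Type := EuclideanSpace ℝ (Fin 2)

/-- The Euclidean length of a wave number. -/
def Mode.len (k : Mode) : ℝ := √((k.1 0 : ℝ) ^ 2 + (k.1 1 : ℝ) ^ 2)

/-- The eigenvalue of minus the Laplacian that belongs to the wave number `k`. -/
def eig (L : ℝ) (k : Mode) : ℝ := (2 * Real.pi * k.len / L) ^ 2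

/-- The one-dimensional real trigonometric basis of the square integrable functions
on the interval from `0` to `L`. -/
def trig (L : ℝ) (m : ℤ) (z : ℝ) : ℝ :=
  if 0 < m then √(2 / L) * Real.sin (2 * Real.pi * m / L * z)
  else if m = 0 then 1 / √L
  else √(2 / L) * Real.cos (2 * Real.pi * m / L * z)

/-- The eigenfunction with wave number `k`. -/
def eigenfun (L : ℝ) (k : Mode) (x : Point) : ℝ :=
  trig L (k.1 0) (x 0) * trig L (k.1 1) (x 1)

/-- The gradient of the eigenfunction with wave number `k`. -/
def gradEigenfun (L : ℝ) (k : Mode) (x : Point) : Vec :=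
  !₂[deriv (trig L (k.1 0)) (x 0) * trig L (k.1 1) (x 1),
     trig L (k.1 0) (x 0) * deriv (trig L (k.1 1)) (x 1)]

/-- Lebesgue measure on the square with side `L`. -/
def squareMeasure (L : ℝ) : Measure Point :=
  volume.restrict (Set.Icc (0 : Point) (fun _ => L))

/-- Square integrable vector fields on the square. -/
abbrev L2Vec (L : ℝ) : Type := Lp Vec 2 (squareMeasure L)

instance (L : ℝ) : IsFiniteMeasure (squareMeasure L) := by
  unfold squareMeasure
  exact ⟨by
    rw [Measure.restrict_apply_univ]
    exact isCompact_Icc.measure_lt_top⟩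

section aux

variable (L : ℝ)

theorem hasDerivAt_trig (m : ℤ) (z : ℝ) :
    HasDerivAt (trig L m) (2 * Real.pi * m / L * trig L (-m) z) z := by
  have hl : HasDerivAt (fun z : ℝ => 2 * Real.pi * m / L * z) (2 * Real.pi * m / L) z := by
    simpa using (hasDerivAt_id z).const_mul (2 * Real.pi * m / L)
  have hneg : 2 * Real.pi * ((-m : ℤ) : ℝ) / L * z = -(2 * Real.pi * m / L * z) := by
    push_cast; ring
  rcases lt_trichotomy m 0 with hm | hm | hm
  · have e : trig L m = fun z => √(2 / L) * Real.cos (2 * Real.pi * m / L * z) := by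
      funext z; simp [trig, hm.not_gt, hm.ne]
    rw [e]
    refine (hl.cos.const_mul (√(2 / L))).congr_deriv ?_
    have h1 : trig L (-m) z = √(2 / L) * Real.sin (2 * Real.pi * ((-m : ℤ) : ℝ) / L * z) := by
      simp only [trig]; rw [if_pos (by omega)]
    rw [h1, hneg, Real.sin_neg]; ring
  · subst hm
    have e : trig L 0 = fun _ => 1 / √L := by funext z; simp [trig]
    rw [e]
    simpa using hasDerivAt_const z (1 / √L)
  · have e : trig L m = fun z => √(2 / L) * Real.sin (2 * Real.pi * m / L * z) := by
      funext z; simp [trig, hm]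
    rw [e]
    refine (hl.sin.const_mul (√(2 / L))).congr_deriv ?_
    have h1 : trig L (-m) z = √(2 / L) * Real.cos (2 * Real.pi * ((-m : ℤ) : ℝ) / L * z) := by
      simp only [trig]; rw [if_neg (by omega), if_neg (by omega)]
    rw [h1, hneg, Real.cos_neg]; ring

theorem deriv_trig (m : ℤ) (z : ℝ) :
    deriv (trig L m) z = 2 * Real.pi * m / L * trig L (-m) z := (hasDerivAt_trig L m z).deriv

theorem continuous_trig (m : ℤ) : Continuous (trig L m) :=
  continuous_iff_continuousAt.2 fun z => (hasDerivAt_trig L m z).continuousAt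

theorem continuous_gradEigenfun (k : Mode) : Continuous (gradEigenfun L k) := by
  have h (m : ℤ) := continuous_trig L m
  unfold gradEigenfun
  simp only [deriv_trig]
  fun_prop

theorem memLp_gradEigenfun (k : Mode) : MemLp (gradEigenfun L k) 2 (squareMeasure L) := by
  obtain ⟨C, hC⟩ := (isCompact_Icc (a := (0 : Point)) (b := fun _ => L)).exists_bound_of_continuousOn
    (continuous_gradEigenfun L k).continuousOn
  refine MemLp.of_bound (continuous_gradEigenfun L k).aestronglyMeasurable C ?_
  exact (ae_restrict_iff' measurableSet_Icc).2 (Eventually.of_forall hC)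

theorem integral_cos_mode [hL : Fact (0 < L)] (n : ℤ) :
    ∫ z in (0 : ℝ)..L, Real.cos (2 * Real.pi * n / L * z) = if n = 0 then L else 0 := by
  have hL' := hL.out.ne'
  split_ifs with h
  · subst h; simp
  · have hn : (n : ℝ) ≠ 0 := by exact_mod_cast h
    have hc : 2 * Real.pi * n / L ≠ 0 := by positivity
    rw [intervalIntegral.integral_comp_mul_left _ hc, integral_cos]
    have : 2 * Real.pi * n / L * L = ((2 * n : ℤ) : ℝ) * Real.pi := by
      push_cast; field_simp
    rw [this, Real.sin_int_mul_pi]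
    simp

theorem integral_sin_mode [hL : Fact (0 < L)] (n : ℤ) :
    ∫ z in (0 : ℝ)..L, Real.sin (2 * Real.pi * n / L * z) = 0 := by
  have hL' := hL.out.ne'
  by_cases h : n = 0
  · subst h; simp
  · have hn : (n : ℝ) ≠ 0 := by exact_mod_cast h
    have hc : 2 * Real.pi * n / L ≠ 0 := by positivity
    rw [intervalIntegral.integral_comp_mul_left _ hc, integral_sin]
    have : 2 * Real.pi * n / L * L = (n : ℝ) * (2 * Real.pi) := by
      field_simp
    rw [this, Real.cos_int_mul_two_pi]
    simp


theorem integral_trig_mul_trig [hL : Fact (0 < L)] (j k : ℤ) :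
    ∫ z in (0 : ℝ)..L, trig L j z * trig L k z = if j = k then 1 else 0 := by
  have hL' := hL.out.ne'
  have hL0 := hL.out
  have hsq : √(2 / L) * √(2 / L) = 2 / L := Real.mul_self_sqrt (by positivity)
  have hsq1 : (1 / √L) * (1 / √L) = 1 / L := by
    rw [div_mul_div_comm, Real.mul_self_sqrt hL0.le, one_mul]
  have hcos (n : ℤ) : IntervalIntegrable (fun z => Real.cos (2 * Real.pi * n / L * z)) volume 0 L :=
    (by fun_prop : Continuous fun z => Real.cos (2 * Real.pi * n / L * z)).intervalIntegrable _ _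
  have hsin (n : ℤ) : IntervalIntegrable (fun z => Real.sin (2 * Real.pi * n / L * z)) volume 0 L :=
    (by fun_prop : Continuous fun z => Real.sin (2 * Real.pi * n / L * z)).intervalIntegrable _ _
  have P (m : ℤ) (hm : 0 < m) :
      trig L m = fun z => √(2 / L) * Real.sin (2 * Real.pi * m / L * z) := by
    funext z; simp [trig, hm]
  have N (m : ℤ) (hm : m < 0) :
      trig L m = fun z => √(2 / L) * Real.cos (2 * Real.pi * m / L * z) := by
    funext z; simp [trig, hm.not_gt, hm.ne]
  have O : trig L 0 = fun _ => 1 / √L := by funext z; simp [trig]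
  have a1 (z : ℝ) : 2 * Real.pi * ((j - k : ℤ) : ℝ) / L * z =
      2 * Real.pi * j / L * z - 2 * Real.pi * k / L * z := by push_cast; ring
  have a2 (z : ℝ) : 2 * Real.pi * ((j + k : ℤ) : ℝ) / L * z =
      2 * Real.pi * j / L * z + 2 * Real.pi * k / L * z := by push_cast; ring
  rcases lt_trichotomy j 0 with hj | hj | hj <;> rcases lt_trichotomy k 0 with hk | hk | hk
  · have e : ∀ z, trig L j z * trig L k z = (1 / L) *
        (Real.cos (2 * Real.pi * ((j - k : ℤ) : ℝ) / L * z) +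
          Real.cos (2 * Real.pi * ((j + k : ℤ) : ℝ) / L * z)) := by
      intro z; rw [N j hj, N k hk, a1, a2, Real.cos_sub, Real.cos_add]
      linear_combination (Real.cos (2 * Real.pi * j / L * z) *
        Real.cos (2 * Real.pi * k / L * z)) * hsq
    simp_rw [e]
    rw [intervalIntegral.integral_const_mul, intervalIntegral.integral_add (hcos _) (hcos _),
      integral_cos_mode, integral_cos_mode, if_neg (show j + k ≠ 0 by omega)]
    by_cases h : j = k <;> simp [h, sub_eq_zero, hL']
  · subst hk
    rw [O, N j hj, if_neg (by omega)]
    rw [intervalIntegral.integral_mul_const, intervalIntegral.integral_const_mul,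
      integral_cos_mode, if_neg hj.ne]; simp
  · have e : ∀ z, trig L j z * trig L k z = (1 / L) *
        (Real.sin (2 * Real.pi * ((j + k : ℤ) : ℝ) / L * z) -
          Real.sin (2 * Real.pi * ((j - k : ℤ) : ℝ) / L * z)) := by
      intro z; rw [N j hj, P k hk, a1, a2, Real.sin_sub, Real.sin_add]
      linear_combination (Real.cos (2 * Real.pi * j / L * z) *
        Real.sin (2 * Real.pi * k / L * z)) * hsq
    simp_rw [e]
    rw [intervalIntegral.integral_const_mul, intervalIntegral.integral_sub (hsin _) (hsin _),
      integral_sin_mode, integral_sin_mode, if_neg (by omega)]; simp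
  · subst hj
    rw [O, N k hk, if_neg (by omega)]
    rw [intervalIntegral.integral_const_mul, intervalIntegral.integral_const_mul,
      integral_cos_mode, if_neg hk.ne]; simp
  · subst hj; subst hk
    simp_rw [O, hsq1]
    simp [hL']
  · subst hj
    rw [O, P k hk, if_neg (by omega)]
    rw [intervalIntegral.integral_const_mul, intervalIntegral.integral_const_mul,
      integral_sin_mode]; simp
  · have e : ∀ z, trig L j z * trig L k z = (1 / L) *
        (Real.sin (2 * Real.pi * ((j + k : ℤ) : ℝ) / L * z) +
          Real.sin (2 * Real.pi * ((j - k : ℤ) : ℝ) / L * z)) := by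
      intro z; rw [P j hj, N k hk, a1, a2, Real.sin_sub, Real.sin_add]
      linear_combination (Real.sin (2 * Real.pi * j / L * z) *
        Real.cos (2 * Real.pi * k / L * z)) * hsq
    simp_rw [e]
    rw [intervalIntegral.integral_const_mul, intervalIntegral.integral_add (hsin _) (hsin _),
      integral_sin_mode, integral_sin_mode, if_neg (by omega)]; simp
  · subst hk
    rw [O, P j hj, if_neg (by omega)]
    rw [intervalIntegral.integral_mul_const, intervalIntegral.integral_const_mul,
      integral_sin_mode]; simp
  · have e : ∀ z, trig L j z * trig L k z = (1 / L) *
        (Real.cos (2 * Real.pi * ((j - k : ℤ) : ℝ) / L * z) -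
          Real.cos (2 * Real.pi * ((j + k : ℤ) : ℝ) / L * z)) := by
      intro z; rw [P j hj, P k hk, a1, a2, Real.cos_sub, Real.cos_add]
      linear_combination (Real.sin (2 * Real.pi * j / L * z) *
        Real.sin (2 * Real.pi * k / L * z)) * hsq
    simp_rw [e]
    rw [intervalIntegral.integral_const_mul, intervalIntegral.integral_sub (hcos _) (hcos _),
      integral_cos_mode, integral_cos_mode, if_neg (show j + k ≠ 0 by omega)]
    by_cases h : j = k <;> simp [h, sub_eq_zero, hL']

theorem integral_square_mul [hL : Fact (0 < L)] (f g : ℝ → ℝ) :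
    ∫ x, f (x 0) * g (x 1) ∂(squareMeasure L) =
      (∫ z in (0 : ℝ)..L, f z) * ∫ z in (0 : ℝ)..L, g z := by
  have h0 : squareMeasure L = Measure.pi fun _ : Fin 2 => volume.restrict (Set.Icc (0 : ℝ) L) := by
    unfold squareMeasure
    rw [← Set.pi_univ_Icc, volume_pi, Measure.restrict_pi_pi]
    rfl
  have := integral_fintype_prod_eq_prod (μ := fun _ : Fin 2 => volume.restrict (Set.Icc (0 : ℝ) L))
    (![f, g] : Fin 2 → ℝ → ℝ)
  rw [h0]
  simp only [Fin.prod_univ_two] at this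
  rw [intervalIntegral.integral_of_le hL.out.le, intervalIntegral.integral_of_le hL.out.le,
    ← integral_Icc_eq_integral_Ioc, ← integral_Icc_eq_integral_Ioc]
  simpa using this

theorem Mode.len_sq (k : Mode) : k.len ^ 2 = (k.1 0 : ℝ) ^ 2 + (k.1 1 : ℝ) ^ 2 :=
  Real.sq_sqrt (by positivity)

theorem Mode.len_pos (k : Mode) : 0 < k.len := by
  refine Real.sqrt_pos.2 ?_
  have : k.1 0 ≠ 0 ∨ k.1 1 ≠ 0 := by
    by_contra! h
    exact k.2 (by ext i; fin_cases i <;> simp [h.1, h.2])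
  rcases this with h | h
  · have : (k.1 0 : ℝ) ≠ 0 := by exact_mod_cast h
    positivity
  · have : (k.1 1 : ℝ) ≠ 0 := by exact_mod_cast h
    positivity

theorem one_le_len (k : Mode) : 1 ≤ k.len := by
  have h : 0 < k.len ^ 2 := by have := k.len_pos; positivity
  rw [k.len_sq] at h
  have h1 : (1 : ℝ) ≤ k.len ^ 2 := by
    rw [k.len_sq]
    exact_mod_cast (show (0 : ℤ) < k.1 0 ^ 2 + k.1 1 ^ 2 by exact_mod_cast h)
  nlinarith [k.len_pos]

theorem eig_pos [hL : Fact (0 < L)] (k : Mode) : 0 < eig L k := by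
  have := hL.out
  have := k.len_pos
  unfold eig; positivity

/-- The gradient of an eigenfunction as a square integrable vector field. -/
def gradLp (k : Mode) : L2Vec L := (memLp_gradEigenfun L k).toLp _

theorem inner_gradLp [hL : Fact (0 < L)] (j k : Mode) :
    inner ℝ (gradLp L j) (gradLp L k) = if j = k then eig L k else 0 := by
  have hL0 := hL.out
  rw [L2.inner_def]
  have h1 : ∫ x, inner ℝ (gradLp L j x) (gradLp L k x) ∂(squareMeasure L) =
      ∫ x, inner ℝ (gradEigenfun L j x) (gradEigenfun L k x) ∂(squareMeasure L) := by
    refine integral_congr_ae ?_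
    filter_upwards [(memLp_gradEigenfun L j).coeFn_toLp, (memLp_gradEigenfun L k).coeFn_toLp]
      with x hj hk
    simp only [gradLp, hj, hk]
  have h2 : ∀ x, inner ℝ (gradEigenfun L j x) (gradEigenfun L k x) =
      (2 * Real.pi / L) ^ 2 * (j.1 0 * k.1 0) *
        ((trig L (-j.1 0) (x 0) * trig L (-k.1 0) (x 0)) *
          (trig L (j.1 1) (x 1) * trig L (k.1 1) (x 1))) +
      (2 * Real.pi / L) ^ 2 * (j.1 1 * k.1 1) *
        ((trig L (j.1 0) (x 0) * trig L (k.1 0) (x 0)) *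
          (trig L (-j.1 1) (x 1) * trig L (-k.1 1) (x 1))) := by
    intro x
    simp only [gradEigenfun, deriv_trig, PiLp.inner_apply, Fin.sum_univ_two]
    simp
    ring
  have hc (m : ℤ) := continuous_trig L m
  have hint (f : Point → ℝ) (hf : Continuous f) : Integrable f (squareMeasure L) :=
    hf.continuousOn.integrableOn_compact isCompact_Icc
  rw [h1]
  simp_rw [h2]
  rw [integral_add (hint _ (by fun_prop)) (hint _ (by fun_prop)), integral_const_mul,
    integral_const_mul,
    integral_square_mul L (fun z => trig L (-j.1 0) z * trig L (-k.1 0) z)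
      (fun z => trig L (j.1 1) z * trig L (k.1 1) z),
    integral_square_mul L (fun z => trig L (j.1 0) z * trig L (k.1 0) z)
      (fun z => trig L (-j.1 1) z * trig L (-k.1 1) z)]
  simp only [integral_trig_mul_trig, neg_inj]
  by_cases h : j = k
  · subst h
    simp only [if_true, eig, div_pow, mul_pow, j.len_sq]
    ring
  · rw [if_neg h]
    have : ¬ (j.1 0 = k.1 0 ∧ j.1 1 = k.1 1) := fun hh =>
      h (Subtype.ext (by ext i; fin_cases i <;> simp [hh.1, hh.2]))
    by_cases h0 : j.1 0 = k.1 0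
    · have h3 : j.1 1 ≠ k.1 1 := fun h3 => this ⟨h0, h3⟩
      simp [h3]
    · simp [h0]

theorem orthonormal_gradLp [hL : Fact (0 < L)] :
    Orthonormal ℝ fun k : Mode => (√(eig L k))⁻¹ • gradLp L k := by
  classical
  rw [orthonormal_iff_ite]
  intro j k
  rw [inner_smul_left, inner_smul_right, inner_gradLp]
  by_cases h : j = k
  · subst h
    have := eig_pos L j
    have h2 := Real.mul_self_sqrt this.le
    have h3 : √(eig L j) ≠ 0 := (Real.sqrt_pos.2 this).ne'
    simp only [if_true, conj_trivial]
    field_simp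
    linarith
  · simp [h]

end aux

/-! ## Sobolev spaces of periodic functions with mean zero -/

/-- Membership of the formal Fourier series with coefficients `u` in the space of order `a`. -/
def IsSobolev (L a : ℝ) (u : Mode → ℝ) : Prop :=
  Summable fun k => eig L k ^ a * u k ^ 2

theorem isSobolev_iff (L : ℝ) [hL : Fact (0 < L)] (a : ℝ) (u : Mode → ℝ) :
    IsSobolev L a u ↔ Memℓp (fun k => eig L k ^ (a / 2) * u k) 2 := by
  rw [memℓp_gen_iff (by norm_num)]
  unfold IsSobolev
  refine summable_congr fun k => ?_
  have h := eig_pos L k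
  have h2 : (eig L k ^ (a / 2)) ^ 2 = eig L k ^ a := by
    rw [← Real.rpow_natCast, ← Real.rpow_mul h.le]; congr 1; push_cast; ring
  simp only [ENNReal.toReal_ofNat, Real.rpow_ofNat, Real.norm_eq_abs, sq_abs, mul_pow, h2]

/-- The coefficient sequences of the Sobolev space of order `a`, as a linear space. -/
def sobolevSubmodule (L : ℝ) [hL : Fact (0 < L)] (a : ℝ) : Submodule ℝ (Mode → ℝ) where
  carrier := {u | IsSobolev L a u}
  zero_mem' := by simp [IsSobolev, summable_zero]
  add_mem' {u v} hu hv := by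
    simp only [Set.mem_ofPred_eq, isSobolev_iff] at *
    convert hu.add hv using 1
    funext k; simp [mul_add]
  smul_mem' c u hu := by
    simp only [Set.mem_ofPred_eq, isSobolev_iff] at *
    convert hu.const_smul c using 1
    funext k; simp; ring

/-- The Sobolev space of order `a` of periodic functions (distributions, if `a` is negative)
with mean zero on the square with side `L`. An element is given by its coefficients with respect
to the basis `eigenfun L`. -/
def Hs (L : ℝ) [Fact (0 < L)] (a : ℝ) : Type := sobolevSubmodule L a

namespace Hs

variable {L : ℝ} [hL : Fact (0 < L)] {a b : ℝ}

instance : AddCommGroup (Hs L a) := inferInstanceAs (AddCommGroup (sobolevSubmodule L a))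

instance : Module ℝ (Hs L a) := inferInstanceAs (Module ℝ (sobolevSubmodule L a))

/-- The Fourier coefficients of an element of a Sobolev space. -/
def coeff (u : Hs L a) (k : Mode) : ℝ := u.1 k

/-- The element of the Sobolev space with given Fourier coefficients. -/
def mk (u : Mode → ℝ) (hu : IsSobolev L a u) : Hs L a := ⟨u, hu⟩

theorem isSobolev_coeff (u : Hs L a) : IsSobolev L a u.coeff := u.2

@[simp] theorem coeff_mk (u : Mode → ℝ) (hu : IsSobolev L a u) : (mk u hu).coeff = u := rfl

@[ext] theorem ext {u v : Hs L a} (h : ∀ k, u.coeff k = v.coeff k) : u = v :=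
  Subtype.ext (funext h)

@[simp] theorem coeff_add (u v : Hs L a) (k : Mode) : (u + v).coeff k = u.coeff k + v.coeff k := rfl

@[simp] theorem coeff_smul (c : ℝ) (u : Hs L a) (k : Mode) : (c • u).coeff k = c * u.coeff k := rfl

@[simp] theorem coeff_zero (k : Mode) : (0 : Hs L a).coeff k = 0 := rfl

/-- The weighted coefficients, as a square summable sequence. -/
def toEll : Hs L a →ₗ[ℝ] lp (fun _ : Mode => ℝ) 2 where
  toFun u := ⟨fun k => eig L k ^ (a / 2) * u.coeff k, (isSobolev_iff L a u.coeff).1 u.2⟩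
  map_add' u v := by
    ext k
    change eig L k ^ (a / 2) * (u.coeff k + v.coeff k) =
      eig L k ^ (a / 2) * u.coeff k + eig L k ^ (a / 2) * v.coeff k
    ring
  map_smul' c u := by
    ext k
    change eig L k ^ (a / 2) * (c * u.coeff k) = c * (eig L k ^ (a / 2) * u.coeff k)
    ring

theorem toEll_apply (u : Hs L a) (k : Mode) : toEll u k = eig L k ^ (a / 2) * u.coeff k := rfl

theorem toEll_injective : Function.Injective (toEll : Hs L a →ₗ[ℝ] _) := by
  intro u v h
  ext k
  have h1 : toEll u k = toEll v k := by rw [h]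
  rw [toEll_apply, toEll_apply] at h1
  exact mul_left_cancel₀ (Real.rpow_pos_of_pos (eig_pos L k) _).ne' h1

theorem toEll_surjective : Function.Surjective (toEll : Hs L a →ₗ[ℝ] _) := by
  intro w
  have e : (fun k => eig L k ^ (a / 2) * ((eig L k ^ (a / 2))⁻¹ * w k)) = fun k => w k := by
    funext k
    rw [mul_inv_cancel_left₀ (Real.rpow_pos_of_pos (eig_pos L k) _).ne']
  refine ⟨mk (fun k => (eig L k ^ (a / 2))⁻¹ * w k) ((isSobolev_iff L a _).2 ?_), ?_⟩
  · rw [e]; exact lp.memℓp w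
  · ext k
    rw [toEll_apply, coeff_mk]
    exact congrFun e k

instance : NormedAddCommGroup (Hs L a) :=
  NormedAddCommGroup.induced (Hs L a) (lp (fun _ : Mode => ℝ) 2) toEll toEll_injective

instance : NormedSpace ℝ (Hs L a) :=
  NormedSpace.induced ℝ (Hs L a) (lp (fun _ : Mode => ℝ) 2) toEll

/-- The norm of the Sobolev space. -/
theorem norm_eq (u : Hs L a) : ‖u‖ = √(∑' k, eig L k ^ a * u.coeff k ^ 2) := by
  change ‖toEll u‖ = _
  rw [lp.norm_eq_tsum_rpow (by norm_num), Real.sqrt_eq_rpow]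
  simp only [ENNReal.toReal_ofNat]
  congr 1
  refine tsum_congr fun k => ?_
  have h := eig_pos L k
  have h2 : (eig L k ^ (a / 2)) ^ 2 = eig L k ^ a := by
    rw [← Real.rpow_natCast, ← Real.rpow_mul h.le]; congr 1; push_cast; ring
  simp only [toEll_apply, Real.rpow_ofNat, Real.norm_eq_abs, sq_abs, mul_pow, h2]

instance : CompleteSpace (Hs L a) := by
  have hi : Isometry (toEll : Hs L a → lp (fun _ : Mode => ℝ) 2) :=
    AddMonoidHomClass.isometry_of_norm toEll fun _ => rfl
  refine (hi.isUniformInducing.completeSpace_congr toEll_surjective).2 inferInstance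

/-- The eigenfunction with wave number `k`, as an element of a Sobolev space. -/
def basis (k : Mode) : Hs L a :=
  mk (Pi.single k 1) <| summable_of_ne_finset_zero (s := {k}) fun j hj => by
    simp [Pi.single_eq_of_ne (Finset.notMem_singleton.1 hj)]

/-! ### The semigroup -/

theorem isSobolev_exp {t : ℝ} (ht : 0 < t) (u : Hs L a) :
    IsSobolev L b fun k => Real.exp (-t * eig L k ^ 2) * u.coeff k := by
  obtain ⟨C, hC⟩ : ∃ C : ℝ, ∀ x : ℝ, (2 * Real.pi / L) ^ 2 ≤ x →
      x ^ (b - a) * Real.exp (-t * x ^ 2) ^ 2 ≤ C := by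
    have hpos : 0 < (2 * Real.pi / L) ^ 2 := by have := hL.out; positivity
    set m := (2 * Real.pi / L) ^ 2
    have hlim := tendsto_rpow_mul_exp_neg_mul_atTop_nhds_zero (b - a) (2 * t * m) (by positivity)
    obtain ⟨R, hR⟩ := eventually_atTop.1 (hlim.eventually_le_const zero_lt_one)
    have hcont : ContinuousOn (fun x : ℝ => x ^ (b - a) * Real.exp (-(2 * t * m) * x))
        (Set.Icc m R) := by
      refine ContinuousOn.mul (fun x hx => ?_) (by fun_prop)
      exact (Real.continuousAt_rpow_const _ _
        (Or.inl (hpos.trans_le hx.1).ne')).continuousWithinAt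
    obtain ⟨C, hC⟩ := isCompact_Icc.exists_bound_of_continuousOn hcont
    refine ⟨max C 1, fun x hx => ?_⟩
    have hx0 : 0 < x := hpos.trans_le hx
    have h1 : x ^ (b - a) * Real.exp (-t * x ^ 2) ^ 2 ≤
        x ^ (b - a) * Real.exp (-(2 * t * m) * x) := by
      rw [← Real.exp_nat_mul]
      refine mul_le_mul_of_nonneg_left (Real.exp_le_exp.2 ?_) (by positivity)
      push_cast
      nlinarith [mul_le_mul_of_nonneg_left hx (mul_pos ht hx0).le]
    refine h1.trans ?_
    rcases le_total x R with h | h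
    · exact (le_abs_self _).trans ((hC x ⟨hx, h⟩).trans (le_max_left _ _))
    · exact (hR x h).trans (le_max_right _ _)
  refine (u.isSobolev_coeff.mul_left C).of_nonneg_of_le (fun k => ?_) fun k => ?_
  · have := eig_pos L k; positivity
  · have h := eig_pos L k
    have h1 : (2 * Real.pi / L) ^ 2 ≤ eig L k := by
      have h0 := hL.out
      have := one_le_len k
      have h2 := Real.pi_pos
      unfold eig
      refine pow_le_pow_left₀ (by positivity) ?_ 2
      refine div_le_div_of_nonneg_right ?_ h0.le
      nlinarith
    have h2 := hC _ h1
    have h3 : eig L k ^ b = eig L k ^ (b - a) * eig L k ^ a := by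
      rw [← Real.rpow_add h]; congr 1; ring
    rw [h3]
    calc _ = (eig L k ^ (b - a) * Real.exp (-t * eig L k ^ 2) ^ 2) *
          (eig L k ^ a * u.coeff k ^ 2) := by ring
      _ ≤ _ := by gcongr

open Classical in
/-- The operator at time `t` of the semigroup generated by minus the squared Laplacian, from the
space of order `a` to that of order `b`, for `t > 0`, and for `t = 0` if the orders agree. If the
image is not in the target space, the value is `0` by convention. -/
def semigroup (a b t : ℝ) (u : Hs L a) : Hs L b :=
  if h : IsSobolev L b fun k => Real.exp (-t * eig L k ^ 2) * u.coeff k then mk _ h else 0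

theorem coeff_semigroup {t : ℝ} (ht : 0 < t) (u : Hs L a) (k : Mode) :
    (semigroup a b t u).coeff k = Real.exp (-t * eig L k ^ 2) * u.coeff k := by
  rw [semigroup, dif_pos (isSobolev_exp ht u)]; rfl

theorem semigroup_zero (u : Hs L a) : semigroup a a 0 u = u := by
  have h : (fun k => Real.exp (-0 * eig L k ^ 2) * u.coeff k) = u.coeff := by funext k; simp
  rw [semigroup, dif_pos (by rw [h]; exact u.isSobolev_coeff)]
  ext k
  simp

/-! ### Gradient, divergence and nonlinearity -/

/-- The gradient of an element of the Sobolev space of order one: the Fourier series is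
differentiated term by term, and the sum is taken in the space of square integrable fields. -/
def grad (u : Hs L 1) : L2Vec L := ∑' k, u.coeff k • gradLp L k

theorem hasSum_grad (u : Hs L 1) : HasSum (fun k => u.coeff k • gradLp L k) (grad u) := by
  refine Summable.hasSum ?_
  have h := ((orthonormal_gradLp L).orthogonalFamily.summable_iff_norm_sq_summable
    fun k => √(eig L k) * u.coeff k).2 (u.isSobolev_coeff.congr fun k => by
      rw [Real.rpow_one, norm_mul, mul_pow, Real.norm_eq_abs, Real.norm_eq_abs, sq_abs, sq_abs,
        Real.sq_sqrt (eig_pos L k).le])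
  refine h.congr fun k => ?_
  have h0 := (Real.sqrt_pos.2 (eig_pos L k)).ne'
  rw [LinearIsometry.toSpanSingleton_apply, smul_smul]
  congr 1
  field_simp

/-- The divergence of a square integrable field, in the Sobolev space of order minus one: its
coefficient at `k` is the distributional pairing with the eigenfunction of wave number `k`. -/
def div (g : L2Vec L) : Hs L (-1) :=
  mk (fun k => -∫ x, inner ℝ (gradEigenfun L k x) (g x) ∂(squareMeasure L)) <| by
    have h := (orthonormal_gradLp L).inner_products_summable g
    refine h.congr fun k => ?_
    have e : ∫ x, inner ℝ (gradEigenfun L k x) (g x) ∂(squareMeasure L) =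
        inner ℝ (gradLp L k) g := by
      rw [L2.inner_def]
      refine integral_congr_ae ?_
      filter_upwards [(memLp_gradEigenfun L k).coeFn_toLp] with x hx
      simp only [gradLp, hx]
    have h0 := eig_pos L k
    simp only [e]
    rw [inner_smul_left, Real.norm_eq_abs, sq_abs, Real.rpow_neg_one, mul_pow, neg_sq]
    congr 1
    simp [Real.sq_sqrt h0.le]

end Hs

/-- The flux as a function of the slope. -/
def flux (z : Vec) : Vec := (1 + ‖z‖ ^ 2)⁻¹ • z

theorem continuous_flux : Continuous flux := by
  unfold flux
  have : ∀ z : Vec, 1 + ‖z‖ ^ 2 ≠ 0 := fun z => by positivity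
  fun_prop (disch := assumption)

theorem norm_flux_le (z : Vec) : ‖flux z‖ ≤ 1 := by
  have h : 0 < 1 + ‖z‖ ^ 2 := by positivity
  rw [flux, norm_smul, norm_inv, Real.norm_of_nonneg h.le, inv_mul_le_iff₀ h]
  nlinarith [sq_nonneg (‖z‖ - 1), norm_nonneg z]

theorem memLp_flux {L : ℝ} (g : L2Vec L) : MemLp (fun x => flux (g x)) 2 (squareMeasure L) :=
  MemLp.of_bound (continuous_flux.comp_aestronglyMeasurable (Lp.aestronglyMeasurable g)) 1
    (Eventually.of_forall fun x => norm_flux_le (g x))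

/-- The nonlinearity: the divergence of the flux of the gradient. -/
def nonlin {L : ℝ} [Fact (0 < L)] (u : Hs L 1) : Hs L (-1) :=
  Hs.div ((memLp_flux (Hs.grad u)).toLp _)

/-! ## Noise -/

variable {Ω : Type*} [MeasurableSpace Ω]

/-- Independent standard Brownian motions, the coordinates of a cylindrical Wiener process. -/
def IsCylindricalWiener (P : Measure Ω) (β : Mode → ℝ≥0 → Ω → ℝ) : Prop :=
  (∀ k, IsBrownianReal (β k) P) ∧ iIndepFun (fun k ω t => β k t ω) P

/-- The step function with value `c j` between `τ j` and `τ (j + 1)`, for `j < n`. -/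
def stepFun (n : ℕ) (τ : ℕ → ℝ≥0) (c : ℕ → ℝ) (s : ℝ) : ℝ :=
  ∑ j ∈ Finset.range n, (Set.Ioc (τ j : ℝ) (τ (j + 1))).indicator (fun _ => c j) s

/-- The stochastic integral of the step function `stepFun n τ c` against the process `B`. -/
def stepIntegral (B : ℝ≥0 → Ω → ℝ) (n : ℕ) (τ : ℕ → ℝ≥0) (c : ℕ → ℝ) (ω : Ω) : ℝ :=
  ∑ j ∈ Finset.range n, c j * (B (τ (j + 1)) ω - B (τ j) ω)

/-- `X` is the Wiener integral over the interval from `0` to `t` of the deterministic function `g`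
against the Brownian motion `B`: step functions converge to `g` in the square mean on the interval
while their integrals converge to `X` in the square mean. -/
def IsWienerIntegral (P : Measure Ω) (B : ℝ≥0 → Ω → ℝ) (g : ℝ → ℝ) (t : ℝ≥0) (X : Ω → ℝ) : Prop :=
  MemLp X 2 P ∧ ∀ η : ℝ≥0∞, 0 < η → ∃ (n : ℕ) (τ : ℕ → ℝ≥0) (c : ℕ → ℝ),
    Monotone τ ∧ τ 0 = 0 ∧ τ n = t ∧
    eLpNorm (fun s => stepFun n τ c s - g s) 2 (volume.restrict (Set.Ioc 0 (t : ℝ))) ≤ η ∧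
    eLpNorm (fun ω => stepIntegral B n τ c ω - X ω) 2 P ≤ η

/-- Regularizations of the noise by Fourier multipliers `α ε`, for `ε > 0`: uniformly
bounded, of order `|k| ^ (-δ ε)` with `δ ε > 0`, convergent to one, radially symmetric. -/
structure IsNoiseRegularization (α : ℝ → Mode → ℝ) (δ : ℝ → ℝ) : Prop where
  bounded : ∃ C : ℝ, ∀ ε > 0, ∀ k, |α ε k| ≤ C
  delta_pos : ∀ ε > 0, 0 < δ ε
  decay : ∀ ε > 0, ∃ C : ℝ, ∀ k : Mode, |α ε k| ≤ C * k.len ^ (-δ ε)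
  tendsto_one : ∀ k, Tendsto (fun ε => α ε k) (𝓝[>] 0) (𝓝 1)
  radial : ∀ ε > 0, ∀ j k : Mode, j.len = k.len → α ε j = α ε k

/-- The random variable `Z` is the stochastic convolution at time `t` with the multipliers `α`:
the series of `α k * Zk k * e_k` converges to `Z` in the square mean, in the Sobolev space
of order one, where `Zk k` is the Wiener integral of `exp (-(t - s) μ_k²)`. -/
def IsStochConvAt (P : Measure Ω) (L : ℝ) [Fact (0 < L)] (β : Mode → ℝ≥0 → Ω → ℝ)
    (α : Mode → ℝ) (t : ℝ) (Z : Ω → Hs L 1) : Prop :=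
  AEStronglyMeasurable Z P ∧ ∃ Zk : Mode → Ω → ℝ,
    (∀ k, IsWienerIntegral P (β k) (fun s => Real.exp (-(t - s) * eig L k ^ 2)) t.toNNReal (Zk k)) ∧
    Tendsto (fun S : Finset Mode =>
      eLpNorm (fun ω => Z ω - ∑ k ∈ S, (α k * Zk k ω) • (Hs.basis k : Hs L 1)) 2 P) atTop (𝓝 0)

/-- `Z` is a version of the stochastic convolution on the time interval from `0` to `T` with almost
surely continuous paths in the Sobolev space of order one. -/
def IsContStochConv (P : Measure Ω) (L : ℝ) [Fact (0 < L)] (β : Mode → ℝ≥0 → Ω → ℝ)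
    (α : Mode → ℝ) (T : ℝ) (Z : ℝ → Ω → Hs L 1) : Prop :=
  (∀ t ∈ Set.Icc 0 T, IsStochConvAt P L β α t (Z t)) ∧
  ∀ᵐ ω ∂P, ContinuousOn (fun t => Z t ω) (Set.Icc 0 T)

/-! ## Mild solutions -/

/-- The integrand of the variation of constants formula at time `t`. -/
def driftIntegrand {L : ℝ} [Fact (0 < L)] (v : ℝ → Hs L 1) (t s : ℝ) : Hs L 1 :=
  Hs.semigroup (-1) 1 (t - s) (nonlin (v s))

/-- The right-hand side of the variation of constants formula at time `t` for the path `v`, with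
initial value `u₀`, factor `κ` of the nonlinearity, noise strength `σ`, and with the value `z` of
the stochastic convolution at time `t`. -/
def varConst {L : ℝ} [Fact (0 < L)] (κ σ : ℝ) (u₀ : Hs L 1) (v : ℝ → Hs L 1) (z : Hs L 1)
    (t : ℝ) : Hs L 1 :=
  Hs.semigroup 1 1 t u₀ + κ • (∫ s in (0 : ℝ)..t, driftIntegrand v t s) + σ • z

/-- Mild solutions on the time interval from `0` to `T`: processes with almost surely continuous
paths in the Sobolev space of order one that satisfy the variation of constants formula. -/
structure IsMildSolution (P : Measure Ω) (L : ℝ) [Fact (0 < L)] (κ σ : ℝ)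
    (β : Mode → ℝ≥0 → Ω → ℝ) (α : Mode → ℝ) (u₀ : Hs L 1) (T : ℝ) (u : ℝ → Ω → Hs L 1) :
    Prop where
  aestronglyMeasurable : ∀ t ∈ Set.Icc 0 T, AEStronglyMeasurable (u t) P
  continuousOn : ∀ᵐ ω ∂P, ContinuousOn (fun t => u t ω) (Set.Icc 0 T)
  eq_varConst : ∀ t ∈ Set.Icc 0 T, ∃ Z : Ω → Hs L 1, IsStochConvAt P L β α t Z ∧
    ∀ᵐ ω ∂P, u t ω = varConst κ σ u₀ (fun s => u s ω) (Z ω) t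

end SurfaceGrowth

end

open SurfaceGrowth

namespace SurfaceGrowth

/-! ### Norms, coefficients and truncated Fourier series -/

namespace Hs

variable {L : ℝ} [hL : Fact (0 < L)] {a b : ℝ}

/-! The equation is solved path by path; probability enters only through the regularity of the
stochastic convolution and through measurability.

Deterministic part. The flux $z\mapsto z/(1+|z|^2)$ has Lipschitz constant $1$ (`norm_flux_sub_le`),
and gradient and divergence have norm at most $1$, so the nonlinearity is $1$-Lipschitz from
$\mathcal H^1$ to $\mathcal H^{-1}$ (`norm_nonlin_sub_le`). The semigroup regains the two orders at
the integrable price $t^{-1/2}$ (`norm_semigroup_le`). In the supremum norm with weight $e^{-4\pi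
t}$ the drift term then has Lipschitz constant $\int_0^\infty r^{-1/2}e^{-4\pi r}dr=1/2$, whatever
the length of the time interval. Banach's theorem gives a unique global fixed point, which depends
continuously on the forcing path (`exists_solution_map`).

Stochastic convolution. Integration by parts turns the Wiener integral of an exponential with rate
$l=\mu_k^2$ into a functional `relax` of the Brownian path. If the path is $\gamma$-Hölder with
constant $K_k$, this functional is bounded by $6K_kl^{-\gamma}$ (`abs_relax_le`). For $\gamma<1/2$
the second moments of the $K_k$ have a common bound (`exists_holder_brownian`). For $\gamma$ close
to $1/2$, the decay of $\alpha_k$ makes $\sum_k\mu_k\alpha_k^2\mu_k^{-4\gamma}K_k^2$ finite in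
expectation (`exists_summable_weights`). This sum dominates the series in $\mathcal H^1$ uniformly
in time, whence continuous paths by the Weierstrass test. The isometry for step functions makes the
convolution unique up to null sets.

Conclusion. The solution is the continuous solution map applied to a strongly measurable version of
the random forcing path, hence measurable. For any other mild solution both sides of its equation
are continuous in time, so the exceptional null sets merge into one, and pathwise uniqueness
applies. -/

theorem norm_sq_eq (u : Hs L a) : ‖u‖ ^ 2 = ∑' k, eig L k ^ a * u.coeff k ^ 2 := by
  rw [norm_eq, Real.sq_sqrt]
  exact tsum_nonneg fun k => mul_nonneg (Real.rpow_nonneg (eig_pos L k).le _) (sq_nonneg _)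

theorem norm_le_of_coeff {u : Hs L a} {v : Hs L b} {C : ℝ} (hC : 0 ≤ C)
    (h : ∀ k, eig L k ^ b * v.coeff k ^ 2 ≤ C ^ 2 * (eig L k ^ a * u.coeff k ^ 2)) :
    ‖v‖ ≤ C * ‖u‖ := by
  refine le_of_pow_le_pow_left₀ two_ne_zero (by positivity) ?_
  rw [mul_pow, norm_sq_eq, norm_sq_eq, ← tsum_mul_left]
  exact v.isSobolev_coeff.tsum_le_tsum h (u.isSobolev_coeff.mul_left _)

theorem eig_rpow_mul_coeff_sq_le (u : Hs L a) (k : Mode) :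
    eig L k ^ a * u.coeff k ^ 2 ≤ ‖u‖ ^ 2 := by
  rw [norm_sq_eq]
  exact u.isSobolev_coeff.le_tsum k fun j _ =>
    mul_nonneg (Real.rpow_nonneg (eig_pos L j).le _) (sq_nonneg _)

/-- The Fourier coefficient with wave number `k` as a continuous linear functional. -/
noncomputable def coeffL (k : Mode) : Hs L a →L[ℝ] ℝ :=
  LinearMap.mkContinuous
    { toFun := fun u => u.coeff k
      map_add' := fun _ _ => rfl
      map_smul' := fun _ _ => rfl } (√(eig L k ^ a))⁻¹ fun u => by
    have h0 := Real.rpow_pos_of_pos (eig_pos L k) a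
    rw [inv_mul_eq_div, le_div_iff₀ (Real.sqrt_pos.2 h0)]
    refine le_of_pow_le_pow_left₀ two_ne_zero (norm_nonneg u) ?_
    rw [mul_pow, Real.sq_sqrt h0.le, Real.norm_eq_abs, sq_abs, mul_comm]
    exact eig_rpow_mul_coeff_sq_le u k

@[simp] theorem coeffL_apply (k : Mode) (u : Hs L a) : coeffL k u = u.coeff k := rfl

@[simp] theorem coeff_sub (u v : Hs L a) (k : Mode) :
    (u - v).coeff k = u.coeff k - v.coeff k := map_sub (coeffL k) u v

theorem continuous_coeff (k : Mode) : Continuous fun u : Hs L a => u.coeff k :=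
  (coeffL k).continuous

open Classical in
theorem coeff_basis (k j : Mode) : (basis k : Hs L a).coeff j = if j = k then 1 else 0 :=
  Pi.single_apply k 1 j

open Classical in
theorem coeff_sum_basis (c : Mode → ℝ) (S : Finset Mode) (j : Mode) :
    (∑ k ∈ S, c k • (basis k : Hs L a)).coeff j = if j ∈ S then c j else 0 := by
  rw [← coeffL_apply, map_sum]
  simp [coeff_basis]

/-- The tail bound involves only the majorant `d`. It is therefore uniform over every family of
elements dominated by `d`, which is what the Weierstrass test needs. -/
theorem norm_sub_sum_basis_sq_le (u : Hs L a) {d : Mode → ℝ} (hd : Summable d)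
    (h : ∀ k, eig L k ^ a * u.coeff k ^ 2 ≤ d k) (S : Finset Mode) :
    ‖u - ∑ k ∈ S, u.coeff k • (basis k : Hs L a)‖ ^ 2 ≤ ∑' k : {k // k ∉ S}, d k := by
  classical
  have e : ∑' k : {k // k ∉ S}, d k = ∑' k, ({k | k ∉ S} : Set Mode).indicator d k :=
    tsum_subtype {k | k ∉ S} d
  rw [norm_sq_eq, e]
  refine (isSobolev_coeff _).tsum_le_tsum (fun k => ?_) (hd.indicator _)
  rw [coeff_sub, coeff_sum_basis]
  by_cases hk : k ∈ S
  · simp [hk]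
  · simpa [hk] using h k

theorem hasSum_basis (u : Hs L a) : HasSum (fun k => u.coeff k • (basis k : Hs L a)) u := by
  rw [HasSum, SummationFilter.unconditional_filter, tendsto_iff_norm_sub_tendsto_zero]
  have h := tendsto_tsum_compl_atTop_zero fun k => eig L k ^ a * u.coeff k ^ 2
  have h2 := h.sqrt
  rw [Real.sqrt_zero] at h2
  refine squeeze_zero (fun _ => norm_nonneg _) (fun S => ?_) h2
  rw [norm_sub_rev]
  exact Real.le_sqrt_of_sq_le
    (norm_sub_sum_basis_sq_le u u.isSobolev_coeff (fun _ => le_rfl) S)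

theorem norm_sub_sum_basis_le (u : Hs L a) (S : Finset Mode) :
    ‖u - ∑ k ∈ S, u.coeff k • (basis k : Hs L a)‖ ≤ ‖u‖ := by
  classical
  have h : ‖u - ∑ k ∈ S, u.coeff k • (basis k : Hs L a)‖ ≤ 1 * ‖u‖ := by
    refine norm_le_of_coeff zero_le_one fun k => ?_
    have := Real.rpow_pos_of_pos (eig_pos L k) a
    rw [coeff_sub, coeff_sum_basis]
    by_cases hk : k ∈ S
    · simp only [hk, if_true, sub_self]
      have := sq_nonneg (u.coeff k)
      simp only [ne_eq, OfNat.ofNat_ne_zero, not_false_eq_true, zero_pow, mul_zero]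
      positivity
    · simp [hk]
  rwa [one_mul] at h

/-- The Weierstrass test in Sobolev spaces. -/
theorem continuousOn_of_coeff {X : Type*} [TopologicalSpace X] {s : Set X} {f : X → Hs L a}
    {d : Mode → ℝ} (hd : Summable d) (hf : ∀ k, ContinuousOn (fun x => (f x).coeff k) s)
    (h : ∀ x ∈ s, ∀ k, eig L k ^ a * (f x).coeff k ^ 2 ≤ d k) : ContinuousOn f s := by
  have hu : TendstoUniformlyOn
      (fun (S : Finset Mode) x => ∑ k ∈ S, (f x).coeff k • (basis k : Hs L a)) f atTop s := by
    rw [Metric.tendstoUniformlyOn_iff]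
    intro r hr
    have ht := tendsto_tsum_compl_atTop_zero d
    filter_upwards [ht.eventually_lt_const (show 0 < r ^ 2 by positivity)] with S hS x hx
    rw [dist_eq_norm]
    exact lt_of_pow_lt_pow_left₀ 2 hr.le
      ((norm_sub_sum_basis_sq_le (f x) hd (h x hx) S).trans_lt hS)
  exact hu.continuousOn (Frequently.of_forall fun S =>
    continuousOn_finsetSum _ fun k _ => (hf k).smul continuousOn_const)

/-- The partial Fourier sums are measurable and converge pointwise, so measurability with values in
a Sobolev space reduces to scalar functions. -/
theorem aestronglyMeasurable_of_coeff {X : Type*} [MeasurableSpace X] {μ : Measure X}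
    {f : X → Hs L a} (hf : ∀ k, AEStronglyMeasurable (fun x => (f x).coeff k) μ) :
    AEStronglyMeasurable f μ := by
  refine aestronglyMeasurable_of_tendsto_ae (atTop : Filter (Finset Mode))
    (f := fun S x => ∑ k ∈ S, (f x).coeff k • (basis k : Hs L a)) (fun S => ?_)
    (Eventually.of_forall fun x => ?_)
  · exact Finset.aestronglyMeasurable_fun_sum _ fun k _ => (hf k).smul_const _
  · exact hasSum_basis (f x)

/-! ### Bounds for the semigroup -/

theorem coeff_semigroup_of_nonneg {t : ℝ} (ht : 0 ≤ t) (u : Hs L a) (k : Mode) :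
    (semigroup a a t u).coeff k = Real.exp (-t * eig L k ^ 2) * u.coeff k := by
  rcases ht.eq_or_lt with rfl | ht
  · simp [semigroup_zero]
  · exact coeff_semigroup ht u k

theorem continuousOn_semigroup (u : Hs L a) :
    ContinuousOn (fun t => semigroup a a t u) (Set.Ici 0) := by
  refine continuousOn_of_coeff u.isSobolev_coeff (fun k => ?_) fun t ht k => ?_
  · refine ContinuousOn.congr (f := fun t => Real.exp (-t * eig L k ^ 2) * u.coeff k) ?_
      fun t ht => coeff_semigroup_of_nonneg ht u k
    fun_prop
  · rw [coeff_semigroup_of_nonneg ht, mul_pow]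
    have h0 := Real.rpow_pos_of_pos (eig_pos L k) a
    have h1 : Real.exp (-t * eig L k ^ 2) ≤ 1 := by
      rw [Real.exp_le_one_iff]
      have := mul_nonneg (show 0 ≤ t from ht) (sq_nonneg (eig L k))
      linarith
    have h2 : Real.exp (-t * eig L k ^ 2) ^ 2 ≤ 1 := pow_le_one₀ (Real.exp_nonneg _) h1
    exact mul_le_mul_of_nonneg_left (mul_le_of_le_one_left (sq_nonneg _) h2) h0.le

theorem semigroup_sub {t : ℝ} (ht : 0 < t) (u v : Hs L a) :
    semigroup a b t (u - v) = semigroup a b t u - semigroup a b t v := by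
  ext k
  simp only [coeff_sub, coeff_semigroup ht]
  ring

/-- With $x=t\mu_k^2$, the ratio of the squared weights is $\mu_k^2e^{-2x}=t^{-1}xe^{-2x}$, and
$xe^{-2x}\le1$ because $x\le(1+x)^2\le e^{2x}$. -/
theorem norm_semigroup_le {t : ℝ} (ht : 0 < t) (u : Hs L (-1)) :
    ‖semigroup (-1) 1 t u‖ ≤ t ^ (-(1 / 2) : ℝ) * ‖u‖ := by
  refine norm_le_of_coeff (by positivity) fun k => ?_
  have h0 := eig_pos L k
  have h1 : (t ^ (-(1 / 2) : ℝ)) ^ 2 = t⁻¹ := by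
    rw [← Real.rpow_natCast, ← Real.rpow_mul ht.le, ← Real.rpow_neg_one]
    norm_num
  rw [coeff_semigroup ht, h1, Real.rpow_one, Real.rpow_neg_one, mul_pow]
  have h2 : t * eig L k ^ 2 * Real.exp (-t * eig L k ^ 2) ^ 2 ≤ 1 := by
    set x := t * eig L k ^ 2 with hx
    have hx0 : 0 ≤ x := by positivity
    have e : -t * eig L k ^ 2 = -x := by rw [hx]; ring
    rw [e, Real.exp_neg, inv_pow, ← div_eq_mul_inv, div_le_one (by positivity)]
    have := Real.add_one_le_exp x
    nlinarith
  have h3 : eig L k * (Real.exp (-t * eig L k ^ 2) ^ 2 * u.coeff k ^ 2) =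
      (t * eig L k ^ 2 * Real.exp (-t * eig L k ^ 2) ^ 2) *
        (t⁻¹ * ((eig L k)⁻¹ * u.coeff k ^ 2)) := by
    field_simp
  rw [h3]
  exact mul_le_of_le_one_left (by positivity) h2

theorem continuous_semigroup {t : ℝ} (ht : 0 < t) :
    Continuous (semigroup (-1) 1 t : Hs L (-1) → Hs L 1) := by
  have hlip : LipschitzWith (Real.toNNReal (t ^ (-(1 / 2) : ℝ)))
      (semigroup (-1) 1 t : Hs L (-1) → Hs L 1) := by
    refine LipschitzWith.of_dist_le_mul fun u v => ?_
    rw [dist_eq_norm, dist_eq_norm, ← semigroup_sub ht, Real.coe_toNNReal _ (by positivity)]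
    exact norm_semigroup_le ht _
  exact hlip.continuous

/-! ### Bounds for gradient and divergence -/

theorem grad_sub (u v : Hs L 1) : grad (u - v) = grad u - grad v := by
  refine ((hasSum_grad u).sub (hasSum_grad v)).unique ?_ |>.symm
  simpa only [coeff_sub, sub_smul] using hasSum_grad (u - v)

theorem norm_grad_le (u : Hs L 1) : ‖grad u‖ ≤ ‖u‖ := by
  have hS (S : Finset Mode) : ‖∑ k ∈ S, u.coeff k • gradLp L k‖ ≤ ‖u‖ := by
    refine le_of_pow_le_pow_left₀ two_ne_zero (norm_nonneg u) ?_
    rw [norm_sq_eq, ← real_inner_self_eq_norm_sq, sum_inner]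
    simp only [inner_sum, inner_smul_left, inner_smul_right, inner_gradLp]
    classical
    simp only [mul_ite, mul_zero, Finset.sum_ite_eq]
    refine le_trans (le_of_eq ?_) (u.isSobolev_coeff.sum_le_tsum S fun k _ => by
      have := eig_pos L k
      positivity)
    refine Finset.sum_congr rfl fun k hk => ?_
    rw [if_pos hk, Real.rpow_one, conj_trivial]
    ring
  exact le_of_tendsto (hasSum_grad u).norm (Eventually.of_forall hS)

theorem coeff_div (g : L2Vec L) (k : Mode) : (div g).coeff k = -inner ℝ (gradLp L k) g := by
  rw [L2.inner_def]
  refine congrArg Neg.neg ?_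
  refine integral_congr_ae ?_
  filter_upwards [(memLp_gradEigenfun L k).coeFn_toLp] with x hx
  simp only [gradLp, hx]

theorem div_sub (g h : L2Vec L) : div (g - h) = div g - div h := by
  ext k
  simp only [coeff_sub, coeff_div, inner_sub_right]
  ring

/-- This is Bessel's inequality for the normalized gradients $\mu_k^{-1/2}\nabla e_k$, an
orthonormal system of vector fields. -/
theorem norm_div_le (g : L2Vec L) : ‖div g‖ ≤ ‖g‖ := by
  refine le_of_pow_le_pow_left₀ two_ne_zero (norm_nonneg g) ?_
  rw [norm_sq_eq]
  refine le_trans (le_of_eq ?_) ((orthonormal_gradLp L).tsum_inner_products_le g)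
  refine tsum_congr fun k => ?_
  have h0 := eig_pos L k
  rw [coeff_div, inner_smul_left, Real.norm_eq_abs, sq_abs, Real.rpow_neg_one, mul_pow, neg_sq,
    conj_trivial, inv_pow, Real.sq_sqrt h0.le]

end Hs

/-! ### Lipschitz continuity of the nonlinearity -/

/-- Put $p=|z|$, $q=|w|$, $i=\langle z,w\rangle$ and $A=(1+p^2)(1+q^2)$. After multiplication by
$A^2$, both squared distances split into a radial part with $(p-q)^2$ and an angular part with
$pq-i\ge0$. The claim compares $(1-pq)^2$ with $A^2$ in the first and $A$ with $A^2$ in the second;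
both follow from $A\ge1$ and $(1+pq)^2\le A$. -/
theorem norm_flux_sub_le (z w : Vec) : ‖flux z - flux w‖ ≤ ‖z - w‖ := by
  have hz : 0 < 1 + ‖z‖ ^ 2 := by positivity
  have hw : 0 < 1 + ‖w‖ ^ 2 := by positivity
  refine le_of_pow_le_pow_left₀ two_ne_zero (norm_nonneg _) ?_
  have h1 : ‖flux z - flux w‖ ^ 2 = (1 + ‖z‖ ^ 2)⁻¹ ^ 2 * ‖z‖ ^ 2 -
      2 * ((1 + ‖z‖ ^ 2)⁻¹ * (1 + ‖w‖ ^ 2)⁻¹ * inner ℝ z w) +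
      (1 + ‖w‖ ^ 2)⁻¹ ^ 2 * ‖w‖ ^ 2 := by
    rw [norm_sub_sq_real, flux, flux, norm_smul, norm_smul, real_inner_smul_left,
      real_inner_smul_right, mul_pow, mul_pow, Real.norm_eq_abs, Real.norm_eq_abs, sq_abs, sq_abs]
    ring
  have hi := real_inner_le_norm z w
  rw [h1, norm_sub_sq_real]
  set p := ‖z‖
  set q := ‖w‖
  set i := inner ℝ z w
  have hp : 0 ≤ p := norm_nonneg z
  have hq : 0 ≤ q := norm_nonneg w
  have key : (1 + p ^ 2)⁻¹ ^ 2 * p ^ 2 - 2 * ((1 + p ^ 2)⁻¹ * (1 + q ^ 2)⁻¹ * i) +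
      (1 + q ^ 2)⁻¹ ^ 2 * q ^ 2 =
      (p ^ 2 * (1 + q ^ 2) ^ 2 - 2 * (1 + p ^ 2) * (1 + q ^ 2) * i + q ^ 2 * (1 + p ^ 2) ^ 2) /
        ((1 + p ^ 2) ^ 2 * (1 + q ^ 2) ^ 2) := by
    field_simp
  rw [key, div_le_iff₀ (by positivity)]
  set A := (1 + p ^ 2) * (1 + q ^ 2) with hA
  have hA1 : 1 ≤ A := by
    rw [hA]
    nlinarith [sq_nonneg p, sq_nonneg q, mul_nonneg (sq_nonneg p) (sq_nonneg q)]
  have hpq : (1 + p * q) ^ 2 ≤ A := by rw [hA]; nlinarith [sq_nonneg (p - q)]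
  have e1 : p ^ 2 * (1 + q ^ 2) ^ 2 - 2 * (1 + p ^ 2) * (1 + q ^ 2) * i +
      q ^ 2 * (1 + p ^ 2) ^ 2 = (p - q) ^ 2 * (1 - p * q) ^ 2 + 2 * A * (p * q - i) := by
    rw [hA]; ring
  have e2 : (p ^ 2 - 2 * i + q ^ 2) * ((1 + p ^ 2) ^ 2 * (1 + q ^ 2) ^ 2) =
      (p - q) ^ 2 * A ^ 2 + 2 * A ^ 2 * (p * q - i) := by
    rw [hA]; ring
  rw [e1, e2]
  have h2 : (1 - p * q) ^ 2 ≤ A ^ 2 := by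
    have : 0 ≤ p * q := mul_nonneg hp hq
    nlinarith
  have h3 : A ≤ A ^ 2 := by nlinarith
  have h4 : 0 ≤ p * q - i := by linarith
  nlinarith [mul_le_mul_of_nonneg_left h2 (sq_nonneg (p - q)), mul_le_mul_of_nonneg_right h3 h4]

theorem norm_nonlin_sub_le {L : ℝ} [Fact (0 < L)] (u v : Hs L 1) :
    ‖nonlin u - nonlin v‖ ≤ ‖u - v‖ := by
  rw [nonlin, nonlin, ← Hs.div_sub]
  refine (Hs.norm_div_le _).trans (le_trans ?_ (Hs.norm_grad_le (u - v)))
  rw [Hs.grad_sub]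
  refine Lp.norm_le_norm_of_ae_le ?_
  filter_upwards [(memLp_flux (Hs.grad u)).coeFn_toLp, (memLp_flux (Hs.grad v)).coeFn_toLp,
    Lp.coeFn_sub ((memLp_flux (Hs.grad u)).toLp _) ((memLp_flux (Hs.grad v)).toLp _),
    Lp.coeFn_sub (Hs.grad u) (Hs.grad v)] with x h1 h2 h3 h4
  rw [h3, h4, Pi.sub_apply, Pi.sub_apply, h1, h2]
  exact norm_flux_sub_le _ _

theorem continuous_nonlin {L : ℝ} [Fact (0 < L)] :
    Continuous (nonlin : Hs L 1 → Hs L (-1)) := by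
  have : LipschitzWith 1 (nonlin : Hs L 1 → Hs L (-1)) :=
    LipschitzWith.of_dist_le_mul fun u v => by
      rw [dist_eq_norm, dist_eq_norm, NNReal.coe_one, one_mul]
      exact norm_nonlin_sub_le u v
  exact this.continuous

/-! ### The drift term of the variation of constants formula -/

section drift

variable {L : ℝ} [hL : Fact (0 < L)] {T : ℝ}

theorem driftIntegrand_congr {v v' : ℝ → Hs L 1} (h : EqOn v v' (Icc 0 T)) {t : ℝ}
    (ht : t ∈ Icc 0 T) : EqOn (driftIntegrand v t) (driftIntegrand v' t) (Icc 0 t) := by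
  intro s hs
  rw [driftIntegrand, driftIntegrand, h ⟨hs.1, hs.2.trans ht.2⟩]

theorem varConst_congr {κ σ : ℝ} {u₀ : Hs L 1} {v v' : ℝ → Hs L 1} (h : EqOn v v' (Icc 0 T))
    {t : ℝ} (ht : t ∈ Icc 0 T) (z : Hs L 1) :
    varConst κ σ u₀ v z t = varConst κ σ u₀ v' z t := by
  rw [varConst, varConst, intervalIntegral.integral_congr]
  rw [uIcc_of_le ht.1]
  exact driftIntegrand_congr h ht

theorem norm_driftIntegrand_sub_le (v v' : ℝ → Hs L 1) {s t : ℝ} (h : s < t) :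
    ‖driftIntegrand v t s - driftIntegrand v' t s‖ ≤ (t - s) ^ (-(1 / 2) : ℝ) * ‖v s - v' s‖ := by
  have hst : 0 < t - s := sub_pos.2 h
  rw [driftIntegrand, driftIntegrand, ← Hs.semigroup_sub hst]
  refine (Hs.norm_semigroup_le hst _).trans ?_
  exact mul_le_mul_of_nonneg_left (norm_nonlin_sub_le _ _) (Real.rpow_nonneg hst.le _)

/-- At $s=t$ the semigroup would act at time $0$ from order $-1$ to order $1$, where its value may
be the default $0$. Dropping this endpoint leaves only positive times. -/
theorem ae_restrict_Ioc_lt (t : ℝ) : ∀ᵐ s ∂(volume.restrict (Ioc 0 t)), 0 < s ∧ s < t := by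
  have h : ∀ᵐ s : ℝ ∂volume, s ≠ t := by simp [ae_iff]
  filter_upwards [ae_restrict_mem measurableSet_Ioc, ae_restrict_of_ae h] with s hs hst
  exact ⟨hs.1, lt_of_le_of_ne hs.2 hst⟩

theorem intervalIntegrable_rpow_sub (t : ℝ) :
    IntervalIntegrable (fun s : ℝ => (t - s) ^ (-(1 / 2) : ℝ)) volume 0 t := by
  have h := (intervalIntegral.intervalIntegrable_rpow' (a := t) (b := 0)
    (show (-1 : ℝ) < -(1 / 2) by norm_num)).comp_sub_left t
  simpa using h

theorem intervalIntegrable_driftIntegrand {v : ℝ → Hs L 1} (hv : ContinuousOn v (Icc 0 T)) {t : ℝ}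
    (ht : t ∈ Icc 0 T) : IntervalIntegrable (driftIntegrand v t) volume 0 t := by
  have hv' : ContinuousOn (fun s => nonlin (v s)) (Icc 0 t) :=
    continuous_nonlin.comp_continuousOn (hv.mono (Icc_subset_Icc_right ht.2))
  obtain ⟨C, hC⟩ := isCompact_Icc.exists_bound_of_continuousOn hv'
  refine ((intervalIntegrable_rpow_sub t).mul_const C).mono_fun' ?_ ?_
  · rw [uIoc_of_le ht.1]
    refine Hs.aestronglyMeasurable_of_coeff fun k => ?_
    have h1 : AEStronglyMeasurable
        (fun s => Real.exp (-(t - s) * eig L k ^ 2) * (nonlin (v s)).coeff k)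
        (volume.restrict (Ioc 0 t)) := by
      refine ContinuousOn.aestronglyMeasurable ?_ measurableSet_Ioc
      refine ContinuousOn.mul (by fun_prop) ?_
      exact (Hs.continuous_coeff k).comp_continuousOn (hv'.mono Ioc_subset_Icc_self)
    refine h1.congr ?_
    filter_upwards [ae_restrict_Ioc_lt t] with s hs
    rw [driftIntegrand, Hs.coeff_semigroup (sub_pos.2 hs.2)]
  · rw [uIoc_of_le ht.1]
    filter_upwards [ae_restrict_Ioc_lt t] with s hs
    have hst : 0 < t - s := sub_pos.2 hs.2
    refine (Hs.norm_semigroup_le hst _).trans ?_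
    exact mul_le_mul_of_nonneg_left (hC s ⟨hs.1.le, hs.2.le⟩) (Real.rpow_nonneg hst.le _)

/-- The substitution $r=t-s$ fixes the singularity at $r=0$, so that a single integrable majorant
$Cr^{-1/2}$ serves all $t$ and dominated convergence applies. -/
theorem continuousOn_integral_driftIntegrand {v : ℝ → Hs L 1} (hT : 0 ≤ T)
    (hv : ContinuousOn v (Icc 0 T)) :
    ContinuousOn (fun t => ∫ s in (0 : ℝ)..t, driftIntegrand v t s) (Icc 0 T) := by
  -- The constant extension makes the path continuous on the whole line and its nonlinearity
  -- globally bounded, so that $t-r$ may leave the time interval.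
  set w : ℝ → Hs L 1 := IccExtend hT ((Icc 0 T).domRestrict v) with hw
  have hwc : Continuous w := hv.domRestrict.Icc_extend'
  have hwv : EqOn v w (Icc 0 T) := fun s hs => by
    rw [hw, IccExtend_of_mem hT _ hs]; rfl
  obtain ⟨C, hC⟩ : ∃ C, ∀ s, ‖nonlin (w s)‖ ≤ C := by
    obtain ⟨C, hC⟩ := isCompact_Icc.exists_bound_of_continuousOn
      (continuous_nonlin.comp_continuousOn hv)
    refine ⟨C, fun s => ?_⟩
    exact hC _ (projIcc 0 T hT s).2
  set F : ℝ → ℝ → Hs L 1 := fun t r => if 0 < r then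
    Hs.semigroup (-1) 1 r (nonlin (w (t - r))) else 0 with hF
  have hFc (t : ℝ) (k : Mode) (r : ℝ) : (F t r).coeff k =
      if 0 < r then Real.exp (-r * eig L k ^ 2) * (nonlin (w (t - r))).coeff k else 0 := by
    simp only [hF]
    split_ifs with hr
    · exact Hs.coeff_semigroup hr _ k
    · rfl
  have heq : EqOn (fun t => ∫ s in (0 : ℝ)..t, driftIntegrand v t s)
      (fun t => ∫ r in (0 : ℝ)..t, F t r) (Icc 0 T) := by
    intro t ht
    have h1 := intervalIntegral.integral_comp_sub_left (a := 0) (b := t) (F t) t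
    simp only [sub_self, sub_zero] at h1
    change ∫ s in (0 : ℝ)..t, driftIntegrand v t s = ∫ r in (0 : ℝ)..t, F t r
    rw [← h1, intervalIntegral.integral_of_le ht.1, intervalIntegral.integral_of_le ht.1]
    refine integral_congr_ae ?_
    filter_upwards [ae_restrict_Ioc_lt t] with s hs
    simp only [hF, if_pos (sub_pos.2 hs.2), sub_sub_cancel]
    rw [driftIntegrand, hwv ⟨hs.1.le, hs.2.le.trans ht.2⟩]
  refine ContinuousOn.congr (fun t ht => ContinuousAt.continuousWithinAt ?_) heq
  -- Parameter and upper limit are varied independently and then set equal. The interval from $-1$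
  -- to $T+1$ is used because the limits of integration must be interior points.
  have hmain := intervalIntegral.continuousAt_parametric_primitive_of_dominated (μ := volume) (F := F)
    (fun r => ‖r ^ (-(1 / 2) : ℝ)‖ * C) (-1) (T + 1) (a₀ := 0) (b₀ := t) (x₀ := t)
    (fun x => ?_) (Eventually.of_forall fun x => Eventually.of_forall fun r => ?_)
    (((intervalIntegral.intervalIntegrable_rpow' (by norm_num)).norm).mul_const C)
    (Eventually.of_forall fun r => ?_) ⟨by norm_num, by linarith⟩
    ⟨by linarith [ht.1], by linarith [ht.2]⟩ (by simp)
  · exact hmain.comp (f := fun t : ℝ => (t, t)) (by fun_prop)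
  · refine Hs.aestronglyMeasurable_of_coeff fun k => ?_
    simp only [hFc]
    refine Measurable.aestronglyMeasurable (Measurable.ite measurableSet_Ioi ?_ measurable_const)
    refine Continuous.measurable (Continuous.mul (by fun_prop) ?_)
    exact (Hs.continuous_coeff k).comp (continuous_nonlin.comp (by fun_prop))
  · have hC0 : 0 ≤ C := (norm_nonneg _).trans (hC 0)
    simp only [hF]
    split_ifs with hr
    · refine (Hs.norm_semigroup_le hr _).trans ?_
      exact mul_le_mul (le_abs_self _) (hC _) (norm_nonneg _) (norm_nonneg _)
    · rw [norm_zero]; positivity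
  · simp only [hF]
    split_ifs with hr
    · exact ((Hs.continuous_semigroup hr).comp
        (continuous_nonlin.comp (by fun_prop))).continuousAt
    · exact continuousAt_const

theorem continuousOn_varConst {κ σ : ℝ} {u₀ : Hs L 1} {v z : ℝ → Hs L 1} (hT : 0 ≤ T)
    (hv : ContinuousOn v (Icc 0 T)) (hz : ContinuousOn z (Icc 0 T)) :
    ContinuousOn (fun t => varConst κ σ u₀ v (z t) t) (Icc 0 T) :=
  (((Hs.continuousOn_semigroup u₀).mono fun _ ht => ht.1).add
    ((continuousOn_integral_driftIntegrand hT hv).const_smul κ)).add (hz.const_smul σ)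

/-- The value is $\Gamma(1/2)/\sqrt{4\pi}$; the rate $4\pi$ is chosen to make the contraction
constant exactly $1/2$. -/
theorem integral_rpow_mul_exp :
    ∫ r in Ioi (0 : ℝ), r ^ (-(1 / 2) : ℝ) * Real.exp (-(4 * Real.pi * r)) = 1 / 2 := by
  have h := Real.integral_rpow_mul_exp_neg_mul_Ioi (a := 1 / 2) (r := 4 * Real.pi) (by norm_num)
    (by positivity)
  rw [Real.Gamma_one_half_eq, ← Real.sqrt_eq_rpow, ← Real.sqrt_mul (by positivity)] at h
  have e : 1 / (4 * Real.pi) * Real.pi = (1 / 2) ^ 2 := by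
    have := Real.pi_ne_zero
    field_simp
    norm_num
  rw [e, Real.sqrt_sq (by norm_num)] at h
  refine Eq.trans ?_ h
  norm_num

/-- This is the contraction estimate in the exponentially weighted supremum norm: after $e^{4\pi t}$
is factored out, the kernel $r^{-1/2}e^{-4\pi r}$ remains, with $r=t-s$. -/
theorem norm_integral_driftIntegrand_sub_le {v v' : ℝ → Hs L 1} (hv : ContinuousOn v (Icc 0 T))
    (hv' : ContinuousOn v' (Icc 0 T)) {M : ℝ}
    (h : ∀ s ∈ Icc 0 T, ‖v s - v' s‖ ≤ M * Real.exp (4 * Real.pi * s)) {t : ℝ}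
    (ht : t ∈ Icc 0 T) :
    ‖(∫ s in (0 : ℝ)..t, driftIntegrand v t s) - ∫ s in (0 : ℝ)..t, driftIntegrand v' t s‖ ≤
      1 / 2 * M * Real.exp (4 * Real.pi * t) := by
  -- The integral of a non-integrable function is $0$ by convention, so a nonzero value proves
  -- integrability.
  have hint : IntegrableOn (fun r : ℝ => r ^ (-(1 / 2) : ℝ) * Real.exp (-(4 * Real.pi * r)))
      (Ioi 0) := Integrable.of_integral_ne_zero (by rw [integral_rpow_mul_exp]; norm_num)
  set G : ℝ → ℝ := fun r => r ^ (-(1 / 2) : ℝ) * Real.exp (-(4 * Real.pi * r)) with hG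
  have hGi : IntervalIntegrable G volume 0 t :=
    (intervalIntegrable_iff_integrableOn_Ioc_of_le ht.1).2 (hint.mono_set fun _ hr => hr.1)
  have hM : 0 ≤ M := by
    have := (norm_nonneg _).trans (h 0 ⟨le_rfl, ht.1.trans ht.2⟩)
    simpa using this
  have hGt : IntervalIntegrable (fun s => G (t - s)) volume 0 t := by
    simpa using (hGi.comp_sub_left t).symm
  rw [← intervalIntegral.integral_sub (intervalIntegrable_driftIntegrand hv ht)
    (intervalIntegrable_driftIntegrand hv' ht)]
  calc _ ≤ ∫ s in (0 : ℝ)..t, M * Real.exp (4 * Real.pi * t) * G (t - s) := by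
        refine intervalIntegral.norm_integral_le_of_norm_le ht.1 ?_ (hGt.const_mul _)
        rw [← ae_restrict_iff' measurableSet_Ioc]
        filter_upwards [ae_restrict_Ioc_lt t] with s hs
        refine (norm_driftIntegrand_sub_le v v' hs.2).trans ?_
        have h0 : 0 ≤ (t - s) ^ (-(1 / 2) : ℝ) := Real.rpow_nonneg (sub_pos.2 hs.2).le _
        refine (mul_le_mul_of_nonneg_left (h s ⟨hs.1.le, hs.2.le.trans ht.2⟩) h0).trans_eq ?_
        have e : Real.exp (4 * Real.pi * s) =
            Real.exp (4 * Real.pi * t) * Real.exp (-(4 * Real.pi * (t - s))) := by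
          rw [← Real.exp_add]; congr 1; ring
        simp only [hG]
        rw [e]; ring
    _ = M * Real.exp (4 * Real.pi * t) * ∫ r in (0 : ℝ)..t, G r := by
        rw [intervalIntegral.integral_const_mul]
        have h1 := intervalIntegral.integral_comp_sub_left (a := 0) (b := t) G t
        simp only [sub_self, sub_zero] at h1
        rw [h1]
    _ ≤ M * Real.exp (4 * Real.pi * t) * (1 / 2) := by
        refine mul_le_mul_of_nonneg_left ?_ (by positivity)
        rw [intervalIntegral.integral_of_le ht.1, ← integral_rpow_mul_exp]
        refine setIntegral_mono_set hint ?_ (LE.le.eventuallyLE fun _ hr => hr.1)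
        filter_upwards [ae_restrict_mem measurableSet_Ioi] with r hr
        exact mul_nonneg (Real.rpow_nonneg (le_of_lt hr) _) (Real.exp_nonneg _)
    _ = _ := by ring

end drift

/-! ### Fixed points -/

/-- A perturbation of the identity by a contraction is a homeomorphism. -/
theorem exists_continuous_solution {X : Type*} [NormedAddCommGroup X] [CompleteSpace X]
    {K : ℝ≥0} (hK : K < 1) {Ψ : X → X} (hΨ : LipschitzWith K Ψ) :
    ∃ S : X → X, Continuous S ∧ ∀ y v, v = Ψ v + y ↔ v = S y := by
  have hc (y : X) : ContractingWith K fun v => Ψ v + y :=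
    ⟨hK, LipschitzWith.of_dist_le_mul fun v w => by
      rw [dist_add_right]; exact hΨ.dist_le_mul v w⟩
  have hK' : (0 : ℝ) < 1 - K := sub_pos.2 (by exact_mod_cast hK)
  have hfix (y : X) : (hc y).fixedPoint = Ψ (hc y).fixedPoint + y :=
    ((hc y).fixedPoint_isFixedPt).symm
  refine ⟨fun y => (hc y).fixedPoint, ?_, fun y v => ⟨fun h => ?_, fun h => ?_⟩⟩
  · refine LipschitzWith.continuous (K := Real.toNNReal (1 - K)⁻¹)
      (LipschitzWith.of_dist_le_mul fun y y' => ?_)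
    rw [Real.coe_toNNReal _ (inv_nonneg.2 hK'.le), inv_mul_eq_div, le_div_iff₀ hK']
    have h1 := dist_add_add_le (Ψ (hc y).fixedPoint) y (Ψ (hc y').fixedPoint) y'
    rw [← hfix, ← hfix] at h1
    have h2 := hΨ.dist_le_mul (hc y).fixedPoint (hc y').fixedPoint
    linarith
  · exact (hc y).fixedPoint_unique h.symm
  · rw [h]; exact hfix y

/-- Solvability for maps on a space of continuous functions which contract with respect to a
weighted supremum norm. -/
theorem exists_continuous_solution_weighted {I E : Type*} [TopologicalSpace I] [CompactSpace I]
    [NormedAddCommGroup E] [NormedSpace ℝ E] [CompleteSpace E] {K : ℝ≥0} (hK : K < 1)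
    (φ : C(I, ℝ)) (hφ : ∀ x, 0 < φ x) {Ψ : C(I, E) → C(I, E)}
    (hΨ : ∀ (M : ℝ) (v w : C(I, E)), 0 ≤ M → (∀ x, ‖v x - w x‖ ≤ M * φ x) →
      ∀ x, ‖Ψ v x - Ψ w x‖ ≤ K * M * φ x) :
    ∃ S : C(I, E) → C(I, E), Continuous S ∧ ∀ y v, v = Ψ v + y ↔ v = S y := by
  set ψ : C(I, ℝ) := ⟨fun x => (φ x)⁻¹, φ.continuous.inv₀ fun x => (hφ x).ne'⟩ with hψ
  have h1 (v : C(I, E)) : φ • ψ • v = v := by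
    ext x
    change φ x • (φ x)⁻¹ • v x = v x
    rw [smul_smul, mul_inv_cancel₀ (hφ x).ne', one_smul]
  have h2 (v : C(I, E)) : ψ • φ • v = v := by
    ext x
    change (φ x)⁻¹ • φ x • v x = v x
    rw [smul_smul, inv_mul_cancel₀ (hφ x).ne', one_smul]
  -- Conjugation with multiplication by the weight turns the weighted estimate into a Lipschitz
  -- bound in the ordinary supremum norm.
  have hlip : LipschitzWith K fun v => ψ • Ψ (φ • v) := by
    refine LipschitzWith.of_dist_le_mul fun v w => ?_
    refine (ContinuousMap.dist_le (by positivity)).2 fun x => ?_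
    have h3 := hΨ (dist v w) (φ • v) (φ • w) dist_nonneg (fun x => ?_) x
    · change dist ((φ x)⁻¹ • Ψ (φ • v) x) ((φ x)⁻¹ • Ψ (φ • w) x) ≤ _
      rw [dist_eq_norm, ← smul_sub, norm_smul, norm_inv, Real.norm_of_nonneg (hφ x).le,
        inv_mul_le_iff₀ (hφ x)]
      linarith
    · change ‖φ x • v x - φ x • w x‖ ≤ _
      rw [← smul_sub, norm_smul, Real.norm_of_nonneg (hφ x).le, mul_comm, ← dist_eq_norm]
      exact mul_le_mul_of_nonneg_right (ContinuousMap.dist_apply_le_dist x) (hφ x).le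
  obtain ⟨S, hS, hS'⟩ := exists_continuous_solution hK hlip
  have hsm (χ : C(I, ℝ)) : Continuous fun v : C(I, E) => χ • v := by
    refine LipschitzWith.continuous (K := ‖χ‖₊) (LipschitzWith.of_dist_le_mul fun v w => ?_)
    refine (ContinuousMap.dist_le (by positivity)).2 fun x => ?_
    change dist (χ x • v x) (χ x • w x) ≤ _
    rw [dist_smul₀]
    exact mul_le_mul (χ.norm_coe_le_norm x) (ContinuousMap.dist_apply_le_dist x) dist_nonneg
      (norm_nonneg _)
  refine ⟨fun y => φ • S (ψ • y), (hsm φ).comp (hS.comp (hsm ψ)), fun y v => ?_⟩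
  have h3 := hS' (ψ • y) (ψ • v)
  simp only [h1] at h3
  rw [← smul_add] at h3
  refine ⟨fun h => ?_, fun h => ?_⟩
  · change v = φ • S (ψ • y)
    rw [← h3.1 (congrArg (ψ • ·) h), h1]
  · have h4 := h3.2 (by rw [h, h2])
    rw [← h1 (Ψ v + y), ← h4, h1]

/-! ### The pathwise solution map -/

section solution

variable {L : ℝ} [hL : Fact (0 < L)] {T : ℝ}

/-- The path on the time interval from `0` to `T` that is given by a path on the unit interval,
extended by constants. -/
noncomputable def rescale (T : ℝ) (w : C(unitInterval, Hs L 1)) (s : ℝ) : Hs L 1 :=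
  w (projIcc 0 1 zero_le_one (s / T))

theorem continuous_rescale (w : C(unitInterval, Hs L 1)) : Continuous (rescale T w) :=
  w.continuous.comp (continuous_projIcc.comp (by fun_prop))

theorem rescale_mul (hT : 0 < T) (w : C(unitInterval, Hs L 1)) (θ : unitInterval) :
    rescale T w (T * θ) = w θ := by
  rw [rescale, mul_div_cancel_left₀ _ hT.ne', projIcc_val]

theorem exists_unitInterval_eq (hT : 0 < T) {t : ℝ} (ht : t ∈ Icc 0 T) :
    ∃ θ : unitInterval, T * θ = t :=
  ⟨⟨t / T, div_nonneg ht.1 hT.le, (div_le_one hT).2 ht.2⟩, mul_div_cancel₀ _ hT.ne'⟩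

theorem mul_mem_Icc (hT : 0 < T) (θ : unitInterval) : T * θ ∈ Icc 0 T :=
  ⟨mul_nonneg hT.le θ.2.1, mul_le_of_le_one_right hT.le θ.2.2⟩

/-- The path on the unit interval that is given by a continuous path on the time interval from
`0` to `T`. -/
theorem exists_rescale_eqOn (hT : 0 < T) {v : ℝ → Hs L 1} (hv : ContinuousOn v (Icc 0 T)) :
    ∃ w : C(unitInterval, Hs L 1), (∀ θ : unitInterval, w θ = v (T * θ)) ∧
      EqOn (rescale T w) v (Icc 0 T) := by
  have hc : Continuous fun θ : unitInterval => v (T * θ) :=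
    hv.comp_continuous (by fun_prop) (mul_mem_Icc hT)
  refine ⟨⟨_, hc⟩, fun θ => rfl, fun t ht => ?_⟩
  obtain ⟨θ, rfl⟩ := exists_unitInterval_eq hT ht
  rw [rescale_mul hT]
  rfl

/-- The fixed point of the variation of constants map depends continuously on the forcing path. -/
theorem exists_solution_map (hT : 0 < T) {κ : ℝ} (hκ : |κ| ≤ 1) (σ : ℝ) (u₀ : Hs L 1) :
    ∃ S : C(unitInterval, Hs L 1) → C(unitInterval, Hs L 1), Continuous S ∧
      ∀ (z : C(unitInterval, Hs L 1)) (v : ℝ → Hs L 1), ContinuousOn v (Icc 0 T) →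
        ((∀ t ∈ Icc 0 T, v t = varConst κ σ u₀ v (rescale T z t) t) ↔
          ∀ t ∈ Icc 0 T, v t = rescale T (S z) t) := by
  have hcont (w : C(unitInterval, Hs L 1)) : Continuous fun θ : unitInterval =>
      κ • ∫ s in (0 : ℝ)..(T * θ), driftIntegrand (rescale T w) (T * θ) s :=
    (((continuousOn_integral_driftIntegrand hT.le (continuous_rescale w).continuousOn).comp_continuous
      (by fun_prop) (mul_mem_Icc hT))).const_smul κ
  set Ψ : C(unitInterval, Hs L 1) → C(unitInterval, Hs L 1) := fun w => ⟨_, hcont w⟩ with hΨ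
  set φ : C(unitInterval, ℝ) := ⟨fun θ => Real.exp (4 * Real.pi * (T * θ)), by fun_prop⟩ with hφ
  -- The map `Ψ` holds only the drift. Initial value and noise form the additive term, on which the
  -- fixed point depends continuously.
  obtain ⟨S, hS, hS'⟩ := exists_continuous_solution_weighted (K := 1 / 2)
    (by rw [← NNReal.coe_lt_coe]; norm_num) φ (fun θ => Real.exp_pos _) (Ψ := Ψ) fun M v w hM h θ => by
      have h1 := norm_integral_driftIntegrand_sub_le (T := T) (M := M)
        (continuous_rescale (T := T) v).continuousOn (continuous_rescale (T := T) w).continuousOn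
        (fun s hs => ?_) (mul_mem_Icc hT θ)
      · change ‖κ • (_ : Hs L 1) - κ • (_ : Hs L 1)‖ ≤ _
        rw [← smul_sub, norm_smul]
        refine (mul_le_of_le_one_left (norm_nonneg _) hκ).trans (h1.trans_eq ?_)
        simp [hφ]
      · obtain ⟨θ, rfl⟩ := exists_unitInterval_eq hT hs
        rw [rescale_mul hT, rescale_mul hT]
        exact h θ
  have hy : Continuous fun θ : unitInterval => Hs.semigroup 1 1 (T * θ) u₀ :=
    (Hs.continuousOn_semigroup u₀).comp_continuous (by fun_prop) fun θ => (mul_mem_Icc hT θ).1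
  set y : C(unitInterval, Hs L 1) := ⟨_, hy⟩ with hy'
  refine ⟨fun z => S (y + σ • z), ?_, fun z v hv => ?_⟩
  · exact hS.comp (continuous_const.add (continuous_id.const_smul σ))
  obtain ⟨w, hw, hwv⟩ := exists_rescale_eqOn hT hv
  have h1 : (∀ t ∈ Icc 0 T, v t = varConst κ σ u₀ v (rescale T z t) t) ↔
      w = Ψ w + (y + σ • z) := by
    have e (θ : unitInterval) : varConst κ σ u₀ v (rescale T z (T * θ)) (T * θ) =
        (Ψ w + (y + σ • z)) θ := by
      rw [rescale_mul hT, varConst_congr hwv.symm (mul_mem_Icc hT θ), varConst]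
      change _ = κ • (_ : Hs L 1) + (Hs.semigroup 1 1 (T * θ) u₀ + σ • z θ)
      abel
    constructor
    · intro h
      ext1 θ
      rw [hw, h _ (mul_mem_Icc hT θ), e]
    · intro h t ht
      obtain ⟨θ, rfl⟩ := exists_unitInterval_eq hT ht
      rw [e, ← h, hw]
  rw [h1, hS']
  constructor
  · intro h t ht
    rw [← hwv ht, h]
  · intro h
    ext1 θ
    rw [hw, h _ (mul_mem_Icc hT θ), rescale_mul hT]

end solution

/-! ### Hölder continuity from dyadic increments -/

section dyadic

/-- A continuous function on the unit interval with small increments along dyadic points is Hölder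
continuous. -/
theorem holder_of_dyadic {γ : ℝ} (hγ : 0 < γ) : ∃ C : ℝ, 0 ≤ C ∧ ∀ (g : ℝ → ℝ) (K : ℝ),
    ContinuousOn g (Icc 0 1) → 0 ≤ K →
    (∀ n j : ℕ, j < 2 ^ n → |g ((j + 1) / 2 ^ n) - g (j / 2 ^ n)| ≤ K * ((2 ^ γ : ℝ)⁻¹) ^ n) →
    ∀ s ∈ Icc (0 : ℝ) 1, ∀ t ∈ Icc (0 : ℝ) 1, |g t - g s| ≤ C * K * |t - s| ^ γ := by
  set q : ℝ := (2 ^ γ : ℝ)⁻¹ with hq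
  have hq0 : 0 < q := by positivity
  have hq1 : q < 1 := inv_lt_one_of_one_lt₀ (Real.one_lt_rpow one_lt_two hγ)
  have hq1' : 0 < 1 - q := sub_pos.2 hq1
  -- The $1$ is one step between neighbours at the level matching $|t-s|$, and $2/(1-q)$ comes from
  -- the two geometric series of finer steps towards $s$ and $t$. The factor $2^\gamma$ is lost in
  -- rounding $|t-s|$ to a power of $1/2$.
  refine ⟨(1 + 2 / (1 - q)) * 2 ^ γ, by positivity, fun g K hg hK h => ?_⟩
  set d : ℝ → ℕ → ℝ := fun x n => ⌊2 ^ n * x⌋₊ / 2 ^ n with hd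
  have hp (n : ℕ) : (0 : ℝ) < 2 ^ n := by positivity
  have hfl (x : ℝ) (hx : 0 ≤ x) (n : ℕ) : (⌊2 ^ n * x⌋₊ : ℝ) ≤ 2 ^ n * x :=
    Nat.floor_le (by positivity)
  have hfl' (x : ℝ) (n : ℕ) : 2 ^ n * x < (⌊2 ^ n * x⌋₊ : ℝ) + 1 := Nat.lt_floor_add_one _
  -- neighbouring dyadic points of the same level
  have hstep (n j j' : ℕ) (h1 : j ≤ j') (h2 : j' ≤ j + 1) (h3 : j' ≤ 2 ^ n) :
      |g (j' / 2 ^ n) - g (j / 2 ^ n)| ≤ K * q ^ n := by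
    rcases (show j' = j ∨ j' = j + 1 by omega) with rfl | rfl
    · rw [sub_self, abs_zero]; positivity
    · have := h n j (by omega)
      push_cast
      exact this
  have hle (x : ℝ) (hx : x ∈ Icc (0 : ℝ) 1) (n : ℕ) : ⌊2 ^ n * x⌋₊ ≤ 2 ^ n := by
    have h1 : (⌊2 ^ n * x⌋₊ : ℝ) ≤ 2 ^ n :=
      (hfl x hx.1 n).trans (mul_le_of_le_one_right (hp n).le hx.2)
    exact_mod_cast h1
  have hdm (x : ℝ) (hx : x ∈ Icc (0 : ℝ) 1) (n : ℕ) : d x n ∈ Icc (0 : ℝ) 1 := by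
    refine ⟨by positivity, (div_le_one (hp n)).2 ?_⟩
    exact_mod_cast hle x hx n
  have happ (x : ℝ) (hx : x ∈ Icc (0 : ℝ) 1) (n : ℕ) :
      |g (d x n) - g x| ≤ K * q ^ n / (1 - q) := by
    -- The floor at level $n+1$ is twice the floor at level $n$, or one more, so passing to the next
    -- level costs at most one step.
    have hu (n : ℕ) : dist (g (d x n)) (g (d x (n + 1))) ≤ K * q ^ n := by
      have e : d x n = ((2 * ⌊2 ^ n * x⌋₊ : ℕ) : ℝ) / 2 ^ (n + 1) := by
        simp only [hd]
        push_cast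
        rw [pow_succ]
        field_simp
      have h1 := hfl x hx.1 n
      have h2 := hfl' x n
      have h3 := hfl x hx.1 (n + 1)
      have h4 := hfl' x (n + 1)
      rw [pow_succ] at h3 h4
      have h5 : ((2 * ⌊2 ^ n * x⌋₊ : ℕ) : ℝ) < ((⌊2 ^ (n + 1) * x⌋₊ + 1 : ℕ) : ℝ) := by
        rw [pow_succ]; push_cast; linarith
      have h6 : ((⌊2 ^ (n + 1) * x⌋₊ : ℕ) : ℝ) < ((2 * ⌊2 ^ n * x⌋₊ + 2 : ℕ) : ℝ) := by
        rw [pow_succ]; push_cast; linarith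
      have h5' := Nat.cast_lt.1 h5
      have h6' := Nat.cast_lt.1 h6
      rw [dist_comm, Real.dist_eq, e]
      refine (hstep (n + 1) _ _ (by omega) (by omega) (hle x hx (n + 1))).trans ?_
      exact mul_le_mul_of_nonneg_left (pow_le_pow_of_le_one hq0.le hq1.le n.le_succ) hK
    have hlim : Tendsto (d x) atTop (𝓝 x) := by
      have h0 : Tendsto (fun n : ℕ => ((1 : ℝ) / 2) ^ n) atTop (𝓝 0) :=
        tendsto_pow_atTop_nhds_zero_of_lt_one (by norm_num) (by norm_num)
      refine tendsto_iff_dist_tendsto_zero.2 (squeeze_zero (fun _ => dist_nonneg) (fun n => ?_) h0)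
      have h1 := hfl x hx.1 n
      have h2 := hfl' x n
      rw [dist_comm, Real.dist_eq, one_div, inv_pow, ← one_div, le_div_iff₀ (hp n)]
      have e : (x - d x n) = (2 ^ n * x - ⌊2 ^ n * x⌋₊) / 2 ^ n := by
        simp only [hd]
        field_simp
      rw [e, abs_div, abs_of_pos (hp n), div_mul_cancel₀ _ (hp n).ne', abs_le]
      constructor <;> linarith
    have hg' : Tendsto (fun n => g (d x n)) atTop (𝓝 (g x)) :=
      (hg x hx).tendsto.comp (tendsto_nhdsWithin_iff.2 ⟨hlim, Eventually.of_forall (hdm x hx)⟩)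
    have := dist_le_of_le_geometric_of_tendsto q K hq1 hu hg' n
    rwa [Real.dist_eq] at this
  have hlt : ∀ s ∈ Icc (0 : ℝ) 1, ∀ t ∈ Icc (0 : ℝ) 1, s < t →
      |g t - g s| ≤ (1 + 2 / (1 - q)) * 2 ^ γ * K * |t - s| ^ γ := by
    intro s hs t ht hst
    have hts : 0 < t - s := sub_pos.2 hst
    -- This is the level with $2^{-(n+1)}<t-s\le2^{-n}$, at which the dyadic points below $s$ and
    -- $t$ coincide or are neighbours.
    obtain ⟨n, hn1, hn2⟩ := exists_nat_pow_near_of_lt_one hts (by linarith [hs.1, ht.2])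
      (show (0 : ℝ) < 1 / 2 by norm_num) (by norm_num)
    have hn2' : 2 ^ n * (t - s) ≤ 1 := by
      rw [one_div, inv_pow, ← one_div, le_div_iff₀ (hp n)] at hn2
      linarith
    have h1 : ⌊2 ^ n * s⌋₊ ≤ ⌊2 ^ n * t⌋₊ :=
      Nat.floor_mono (mul_le_mul_of_nonneg_left hst.le (hp n).le)
    have h2 : ⌊2 ^ n * t⌋₊ ≤ ⌊2 ^ n * s⌋₊ + 1 := by
      have h3 := hfl t ht.1 n
      have h4 := hfl' s n
      have h5 : ((⌊2 ^ n * t⌋₊ : ℕ) : ℝ) < ((⌊2 ^ n * s⌋₊ + 1 + 1 : ℕ) : ℝ) := by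
        push_cast; linarith
      have := Nat.cast_lt.1 h5
      omega
    have hA := hstep n _ _ h1 h2 (hle t ht n)
    have hB := happ t ht n
    have hC := happ s hs n
    have htri : |g t - g s| ≤ K * q ^ n / (1 - q) + K * q ^ n + K * q ^ n / (1 - q) := by
      rw [abs_le] at hA hB hC ⊢
      simp only [hd] at hB hC
      constructor <;> linarith [hA.1, hA.2, hB.1, hB.2, hC.1, hC.2]
    have hqn : q ^ n ≤ 2 ^ γ * |t - s| ^ γ := by
      rw [abs_of_pos hts, ← Real.mul_rpow (by norm_num) hts.le]
      have e : q ^ n = ((1 / 2) ^ n : ℝ) ^ γ := by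
        rw [hq, ← Real.inv_rpow (by norm_num), ← Real.rpow_natCast, ← Real.rpow_mul (by norm_num),
          ← Real.rpow_natCast, ← Real.rpow_mul (by norm_num), mul_comm, one_div]
      rw [e]
      refine Real.rpow_le_rpow (by positivity) ?_ hγ.le
      rw [pow_succ] at hn1
      linarith
    calc |g t - g s| ≤ (1 + 2 / (1 - q)) * K * q ^ n := by
          refine htri.trans_eq ?_
          field_simp
          ring
      _ ≤ (1 + 2 / (1 - q)) * K * (2 ^ γ * |t - s| ^ γ) :=
          mul_le_mul_of_nonneg_left hqn (by positivity)
      _ = _ := by ring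
  intro s hs t ht
  rcases lt_trichotomy s t with hst | rfl | hst
  · exact hlt s hs t ht hst
  · rw [sub_self, abs_zero]; positivity
  · rw [abs_sub_comm, abs_sub_comm t s]
    exact hlt t ht s hs hst

end dyadic

/-! ### Second moments of Hölder constants of Brownian paths -/

section brownian

variable {Ω : Type*} [MeasurableSpace Ω] {P : Measure Ω}

theorem lintegral_enorm_pow_gaussianReal (p : ℕ) (v : ℝ≥0) :
    ∫⁻ x, ‖x‖ₑ ^ p ∂(gaussianReal 0 v) =
      ENNReal.ofReal (√v ^ p) * ∫⁻ x, ‖x‖ₑ ^ p ∂(gaussianReal 0 1) := by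
  have h := gaussianReal_map_const_mul (μ := 0) (v := 1) (√v)
  have e : NNReal.mk (√v ^ 2) (sq_nonneg _) * 1 = v := by
    ext; simp
  rw [mul_zero, e] at h
  rw [← h, lintegral_map (by fun_prop) (by fun_prop), ← lintegral_const_mul _ (by fun_prop)]
  refine lintegral_congr fun x => ?_
  rw [enorm_mul, mul_pow, ENNReal.ofReal_pow (Real.sqrt_nonneg _),
    Real.enorm_of_nonneg (Real.sqrt_nonneg _)]

theorem lintegral_enorm_pow_gaussianReal_lt_top (p : ℕ) :
    ∫⁻ x, ‖x‖ₑ ^ p ∂(gaussianReal 0 1) < ∞ := by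
  rcases eq_or_ne p 0 with rfl | hp
  · simp
  have h := (memLp_id_gaussianReal (μ := 0) (v := 1) (p : ℝ≥0)).2
  rw [eLpNorm_lt_top_iff_lintegral_rpow_enorm_lt_top (by simpa using hp) (by simp)] at h
  simpa using h

theorem lintegral_enorm_sub_pow_brownian {B : ℝ≥0 → Ω → ℝ} (hB : IsPreBrownianReal B P) (p : ℕ)
    (s t : ℝ≥0) : ∫⁻ ω, ‖B t ω - B s ω‖ₑ ^ p ∂P =
      ENNReal.ofReal (√(nndist t.1 s.1) ^ p) * ∫⁻ x, ‖x‖ₑ ^ p ∂(gaussianReal 0 1) := by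
  rw [← lintegral_enorm_pow_gaussianReal, ← (hB.hasLaw_sub t s).map_eq,
    lintegral_map' (by fun_prop) (hB.hasLaw_sub t s).aemeasurable]
  rfl

/-- Brownian paths are Hölder continuous of any order below one half, with a Hölder constant whose
second moment is bounded in terms of the order and the time interval. -/
theorem exists_holder_brownian [IsProbabilityMeasure P] {γ T : ℝ} (hγ : 0 < γ) (hγ' : γ < 1 / 2)
    (hT : 0 < T) : ∃ M : ℝ≥0∞, M ≠ ∞ ∧ ∀ B : ℝ≥0 → Ω → ℝ, IsBrownianReal B P →
      ∃ K : Ω → ℝ≥0, AEMeasurable K P ∧ ∫⁻ ω, (K ω : ℝ≥0∞) ^ 2 ∂P ≤ M ∧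
        ∀ᵐ ω ∂P, ∀ s ∈ Icc 0 T, ∀ t ∈ Icc 0 T,
          |B t.toNNReal ω - B s.toNNReal ω| ≤ K ω * |t - s| ^ γ := by
  obtain ⟨C, hC, hdy⟩ := holder_of_dyadic hγ
  -- The second bound makes the moment series below converge, as in Kolmogorov's criterion; $p\ge2$
  -- gives $x^{2/p}\le1+x$ for the second moment.
  obtain ⟨p, hp2, hp⟩ : ∃ p : ℕ, 2 ≤ p ∧ 1 < (1 / 2 - γ) * p := by
    have h0 : 0 < 1 / 2 - γ := by linarith
    obtain ⟨m, hm⟩ := exists_nat_gt (1 / (1 / 2 - γ))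
    refine ⟨m + 2, by omega, ?_⟩
    rw [div_lt_iff₀ h0] at hm
    push_cast
    nlinarith
  set a : ℝ := 2 ^ γ with ha
  have ha0 : 0 < a := by positivity
  -- At level $n$ there are $2^n$ increments, each with $p$-th moment proportional to
  -- $(T/2^n)^{p/2}$ and weight $2^{n\gamma p}$. The expected sum is a multiple of $r^n$, and $r<1$
  -- because $(1/2-\gamma)p>1$.
  set r : ℝ := 2 * (a / √2) ^ p with hr
  have hr0 : 0 ≤ r := by positivity
  have hr1 : r < 1 := by
    have h1 : a / √2 = 2 ^ (-(1 / 2 - γ)) := by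
      rw [ha, Real.sqrt_eq_rpow, ← Real.rpow_sub two_pos]; congr 1; ring
    rw [hr, h1, ← Real.rpow_natCast, ← Real.rpow_mul two_pos.le]
    have h2 : (2 : ℝ) ^ (-(1 / 2 - γ) * (p : ℝ)) < 2 ^ (-1 : ℝ) :=
      Real.rpow_lt_rpow_of_exponent_lt one_lt_two (by linarith)
    rw [Real.rpow_neg_one] at h2
    linarith
  set m := ∫⁻ x, ‖x‖ₑ ^ p ∂(gaussianReal 0 1) with hm
  set A : ℝ≥0∞ := ∑' n : ℕ, ENNReal.ofReal (√T ^ p * r ^ n) * m with hA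
  have hAtop : A ≠ ∞ := by
    rw [hA, ENNReal.tsum_mul_right, ← ENNReal.ofReal_tsum_of_nonneg (fun n => by positivity)
      ((summable_geometric_of_lt_one hr0 hr1).mul_left _)]
    exact ENNReal.mul_ne_top ENNReal.ofReal_ne_top
      (lintegral_enorm_pow_gaussianReal_lt_top p).ne
  set D : ℝ≥0 := NNReal.mk (C * T⁻¹ ^ γ) (by positivity)
  have hD : (D : ℝ) = C * T⁻¹ ^ γ := rfl
  -- The bound is fixed before the Brownian motion, so it is the same for all Fourier modes.
  refine ⟨(D : ℝ≥0∞) ^ 2 * (1 + A), ENNReal.mul_ne_top (by simp) (by simp [hAtop]),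
    fun B hB => ?_⟩
  set Δ : ℕ → ℕ → Ω → ℝ := fun n j ω =>
    B (T * ((j + 1) / 2 ^ n)).toNNReal ω - B (T * (j / 2 ^ n)).toNNReal ω with hΔ
  set Q : Ω → ℝ≥0∞ := fun ω => ∑' n : ℕ, ∑ j ∈ Finset.range (2 ^ n),
    ENNReal.ofReal ((a ^ n) ^ p) * ‖Δ n j ω‖ₑ ^ p with hQ
  have hΔm (n j : ℕ) : AEMeasurable (Δ n j) P := (hB.aemeasurable _).sub (hB.aemeasurable _)
  have hterm (n j : ℕ) :
      AEMeasurable (fun ω => ENNReal.ofReal ((a ^ n) ^ p) * ‖Δ n j ω‖ₑ ^ p) P :=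
    (((hΔm n j).enorm).pow_const p).const_mul _
  have hQm : AEMeasurable Q P :=
    AEMeasurable.tsum fun n => Finset.aemeasurable_fun_sum _ fun j _ => hterm n j
  have hQint : ∫⁻ ω, Q ω ∂P = A := by
    rw [hQ, lintegral_tsum fun n => Finset.aemeasurable_fun_sum _ fun j _ => hterm n j]
    refine tsum_congr fun n => ?_
    rw [lintegral_finsetSum' _ fun j _ => hterm n j]
    have h1 (j : ℕ) : ∫⁻ ω, ENNReal.ofReal ((a ^ n) ^ p) * ‖Δ n j ω‖ₑ ^ p ∂P =
        ENNReal.ofReal ((a ^ n) ^ p * √(T / 2 ^ n) ^ p) * m := by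
      rw [lintegral_const_mul'' _ (((hΔm n j).enorm).pow_const p)]
      simp only [hΔ]
      rw [lintegral_enorm_sub_pow_brownian hB.toIsPreBrownianReal, ← mul_assoc,
        ← ENNReal.ofReal_mul (by positivity)]
      congr 5
      rw [NNReal.val_eq_coe, NNReal.val_eq_coe, Real.coe_toNNReal _ (by positivity),
        Real.coe_toNNReal _ (by positivity), coe_nndist, Real.dist_eq]
      rw [← mul_sub, ← sub_div, add_sub_cancel_left, abs_of_pos (by positivity)]
      ring
    rw [Finset.sum_congr rfl fun j _ => h1 j, Finset.sum_const, Finset.card_range, nsmul_eq_mul,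
      ← mul_assoc]
    congr 1
    rw [← ENNReal.ofReal_natCast, ← ENNReal.ofReal_mul (by positivity)]
    congr 1
    rw [Real.sqrt_div hT.le, hr, div_pow, div_pow, mul_pow, div_pow]
    have e : √(2 ^ n) = √2 ^ n := by
      rw [Real.sqrt_eq_iff_mul_self_eq (by positivity) (by positivity), ← mul_pow,
        Real.mul_self_sqrt (by norm_num)]
    rw [e]
    push_cast
    rw [← pow_mul, ← pow_mul, ← pow_mul, ← pow_mul, mul_comm p n]
    ring
  have hQfin : ∀ᵐ ω ∂P, Q ω ≠ ∞ := by
    filter_upwards [ae_lt_top' hQm (hQint ▸ hAtop)] with ω h using h.ne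
  refine ⟨fun ω => D * (Q ω).toNNReal ^ (1 / p : ℝ), ?_, ?_, ?_⟩
  · exact (hQm.ennreal_toNNReal.pow_const _).const_mul _
  · have h1 : ∀ᵐ ω ∂P, ((D * (Q ω).toNNReal ^ (1 / p : ℝ) : ℝ≥0) : ℝ≥0∞) ^ 2 ≤
        (D : ℝ≥0∞) ^ 2 * (1 + Q ω) := by
      filter_upwards [hQfin] with ω hω
      rw [ENNReal.coe_mul, mul_pow]
      refine mul_le_mul_right ?_ _
      rw [← ENNReal.coe_pow]
      refine le_trans (b := ((1 + (Q ω).toNNReal : ℝ≥0) : ℝ≥0∞)) (ENNReal.coe_le_coe.2 ?_) ?_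
      · set x := (Q ω).toNNReal
        rw [← NNReal.rpow_natCast, ← NNReal.rpow_mul]
        have hp' : (0 : ℝ) < p := by positivity
        have h2 : (1 / p : ℝ) * ((2 : ℕ) : ℝ) ≤ 1 := by
          rw [one_div, inv_mul_le_iff₀ hp', mul_one]
          exact_mod_cast hp2
        rcases le_total x 1 with hx | hx
        · refine (NNReal.rpow_le_one hx (by positivity)).trans ?_
          simp
        · refine (NNReal.rpow_le_rpow_of_exponent_le hx h2).trans ?_
          simp
      · rw [ENNReal.coe_add, ENNReal.coe_toNNReal hω, ENNReal.coe_one]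
    refine (lintegral_mono_ae h1).trans_eq ?_
    rw [lintegral_const_mul'' _ (hQm.const_add 1), lintegral_add_left measurable_const, hQint]
    simp
  · filter_upwards [hQfin, hB.cont] with ω hω hc
    have hpp : p ≠ 0 := by omega
    have h1 := hdy (fun x => B (T * x).toNNReal ω) ((Q ω).toNNReal ^ (1 / p : ℝ) : ℝ≥0) ?_
      (NNReal.coe_nonneg _) ?_
    · intro s hs t ht
      have hm' (x : ℝ) (hx : x ∈ Icc 0 T) : x / T ∈ Icc (0 : ℝ) 1 :=
        ⟨div_nonneg hx.1 hT.le, (div_le_one hT).2 hx.2⟩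
      have h2 := h1 (s / T) (hm' s hs) (t / T) (hm' t ht)
      simp only [mul_div_cancel₀ _ hT.ne'] at h2
      refine h2.trans_eq ?_
      rw [← sub_div, abs_div, abs_of_pos hT, div_eq_mul_inv _ T,
        Real.mul_rpow (abs_nonneg _) (inv_nonneg.2 hT.le)]
      rw [NNReal.coe_mul, hD]
      ring
    · exact (hc.comp (by fun_prop : Continuous fun x => (T * x).toNNReal)).continuousOn
    · intro n j hj
      -- A single weighted increment is at most the whole sum `Q`; its $p$-th root is the dyadic
      -- increment bound.
      have h2 : ENNReal.ofReal ((a ^ n) ^ p) * ‖Δ n j ω‖ₑ ^ p ≤ Q ω := by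
        refine le_trans ?_ (ENNReal.le_tsum n)
        exact Finset.single_le_sum
          (f := fun j => ENNReal.ofReal ((a ^ n) ^ p) * ‖Δ n j ω‖ₑ ^ p)
          (fun _ _ => zero_le) (Finset.mem_range.2 hj)
      rw [← ofReal_norm, ← ENNReal.ofReal_pow (norm_nonneg _),
        ← ENNReal.ofReal_mul (by positivity), ← mul_pow,
        ENNReal.ofReal_le_iff_le_toReal hω] at h2
      have h3 : a ^ n * ‖Δ n j ω‖ ≤ (Q ω).toReal ^ (1 / p : ℝ) := by
        have h4 := Real.rpow_le_rpow (by positivity) h2 (show (0 : ℝ) ≤ 1 / p by positivity)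
        rwa [one_div, Real.pow_rpow_inv_natCast (by positivity) hpp, ← one_div] at h4
      rw [inv_pow, ← div_eq_mul_inv, le_div_iff₀ (by positivity), mul_comm]
      exact h3

end brownian

/-! ### Wiener integrals of step functions -/

section isometry

variable {Ω : Type*} [MeasurableSpace Ω] {P : Measure Ω} {B : ℝ≥0 → Ω → ℝ}

/-- Writing the length of the overlap as a mixed increment of `min` matches it with the covariance
of two Brownian increments. -/
theorem integral_indicator_Ioc_mul {a b c d : ℝ} (hab : a ≤ b) (hcd : c ≤ d) (x y : ℝ) :
    ∫ s, (Ioc a b).indicator (fun _ => x) s * (Ioc c d).indicator (fun _ => y) s =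
      x * y * (min b d - min b c - min a d + min a c) := by
  have e : (fun s => (Ioc a b).indicator (fun _ => x) s * (Ioc c d).indicator (fun _ => y) s) =
      (Ioc (max a c) (min b d)).indicator fun _ => x * y := by
    rw [← Ioc_inter_Ioc]
    funext s
    exact (inter_indicator_mul (fun _ => x) (fun _ => y) s).symm
  rw [e, integral_indicator measurableSet_Ioc, setIntegral_const, Real.volume_real_Ioc, smul_eq_mul]
  have h : max (min b d - max a c) 0 = min b d - min b c - min a d + min a c := by
    simp only [min_def, max_def]
    split_ifs <;> linarith
  rw [h]
  ring

theorem memLp_brownian (hB : IsPreBrownianReal B P) (t : ℝ≥0) : MemLp (B t) 2 P :=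
  (hB.isGaussianProcess.hasGaussianLaw_eval t).memLp_two

theorem integral_mul_brownian [IsProbabilityMeasure P] (hB : IsPreBrownianReal B P) (s t : ℝ≥0) :
    ∫ ω, B s ω * B t ω ∂P = min (s : ℝ) t := by
  have h := hB.covariance_eval s t
  rw [covariance_eq_sub (memLp_brownian hB s) (memLp_brownian hB t), hB.integral_eval s, zero_mul,
    sub_zero] at h
  simpa using h

theorem memLp_stepIntegral (hB : IsPreBrownianReal B P) (n : ℕ) (τ : ℕ → ℝ≥0) (c : ℕ → ℝ) :
    MemLp (stepIntegral B n τ c) 2 P := by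
  unfold stepIntegral
  exact memLp_finsetSum _ fun j _ =>
    ((memLp_brownian hB (τ (j + 1))).sub (memLp_brownian hB (τ j))).const_mul (c j)

theorem memLp_stepFun (n : ℕ) (τ : ℕ → ℝ≥0) (c : ℕ → ℝ) :
    MemLp (stepFun n τ c) 2 volume := by
  unfold stepFun
  exact memLp_finsetSum _ fun j _ =>
    memLp_indicator_const 2 measurableSet_Ioc (c j) (Or.inr (by simp))

/-- By bilinearity it suffices to take one interval of each partition. There both sides are the same
mixed increment of `min`, so no common refinement is needed. -/
theorem integral_stepIntegral_mul [IsProbabilityMeasure P] (hB : IsPreBrownianReal B P) {n n' : ℕ}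
    {τ τ' : ℕ → ℝ≥0} (hτ : Monotone τ) (hτ' : Monotone τ') (c c' : ℕ → ℝ) :
    ∫ ω, stepIntegral B n τ c ω * stepIntegral B n' τ' c' ω ∂P =
      ∫ s, stepFun n τ c s * stepFun n' τ' c' s := by
  have hint (p q : ℝ≥0) : Integrable (fun ω => B p ω * B q ω) P :=
    (memLp_brownian hB p).integrable_mul (memLp_brownian hB q)
  have hterm (i j : ℕ) : Integrable (fun ω => c i * (B (τ (i + 1)) ω - B (τ i) ω) *
      (c' j * (B (τ' (j + 1)) ω - B (τ' j) ω))) P :=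
    (((memLp_brownian hB _).sub (memLp_brownian hB _)).const_mul _).integrable_mul
      (((memLp_brownian hB _).sub (memLp_brownian hB _)).const_mul _)
  have hterm' (i j : ℕ) : Integrable (fun s : ℝ =>
      (Ioc (τ i : ℝ) (τ (i + 1))).indicator (fun _ => c i) s *
        (Ioc (τ' j : ℝ) (τ' (j + 1))).indicator (fun _ => c' j) s) :=
    MemLp.integrable_mul (p := 2) (q := 2)
      (memLp_indicator_const 2 measurableSet_Ioc (c i) (Or.inr (by simp)))
      (memLp_indicator_const 2 measurableSet_Ioc (c' j) (Or.inr (by simp)))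
  simp only [stepIntegral, stepFun, Finset.sum_mul_sum]
  rw [integral_finsetSum _ fun i _ => integrable_finsetSum _ fun j _ => hterm i j,
    integral_finsetSum _ fun i _ => integrable_finsetSum _ fun j _ => hterm' i j]
  refine Finset.sum_congr rfl fun i _ => ?_
  rw [integral_finsetSum _ fun j _ => hterm i j, integral_finsetSum _ fun j _ => hterm' i j]
  refine Finset.sum_congr rfl fun j _ => ?_
  rw [integral_indicator_Ioc_mul (by exact_mod_cast hτ i.le_succ)
    (by exact_mod_cast hτ' j.le_succ)]
  have e : ∀ ω, c i * (B (τ (i + 1)) ω - B (τ i) ω) * (c' j * (B (τ' (j + 1)) ω - B (τ' j) ω)) =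
      c i * c' j * (B (τ (i + 1)) ω * B (τ' (j + 1)) ω - B (τ (i + 1)) ω * B (τ' j) ω -
        B (τ i) ω * B (τ' (j + 1)) ω + B (τ i) ω * B (τ' j) ω) := fun ω => by ring
  simp_rw [e]
  have i1 : Integrable (fun ω => B (τ (i + 1)) ω * B (τ' (j + 1)) ω -
      B (τ (i + 1)) ω * B (τ' j) ω) P := (hint _ _).sub (hint _ _)
  have i2 : Integrable (fun ω => B (τ (i + 1)) ω * B (τ' (j + 1)) ω -
      B (τ (i + 1)) ω * B (τ' j) ω - B (τ i) ω * B (τ' (j + 1)) ω) P := i1.sub (hint _ _)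
  rw [integral_const_mul, integral_add i2 (hint _ _), integral_sub i1 (hint _ _),
    integral_sub (hint _ _) (hint _ _)]
  simp only [integral_mul_brownian hB]

theorem integral_norm_sub_sq {X : Type*} [MeasurableSpace X] {μ : Measure X} {f g : X → ℝ}
    (hf : MemLp f 2 μ) (hg : MemLp g 2 μ) : ∫ x, ‖f x - g x‖ ^ (2 : ℝ) ∂μ =
      ∫ x, f x * f x ∂μ - 2 * ∫ x, f x * g x ∂μ + ∫ x, g x * g x ∂μ := by
  have e : ∀ x, ‖f x - g x‖ ^ (2 : ℝ) = f x * f x - 2 * (f x * g x) + g x * g x := fun x => by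
    rw [Real.rpow_two, Real.norm_eq_abs, sq_abs]; ring
  have h1 : Integrable (fun x => f x * f x) μ := hf.integrable_mul hf
  have h2 : Integrable (fun x => 2 * (f x * g x)) μ := (hf.integrable_mul hg).const_mul 2
  have h3 : Integrable (fun x => g x * g x) μ := hg.integrable_mul hg
  have h4 : Integrable (fun x => f x * f x - 2 * (f x * g x)) μ := h1.sub h2
  simp_rw [e]
  rw [integral_add h4 h3, integral_sub h1 h2, integral_const_mul]

/-- The isometry of the Wiener integral, for step functions on different partitions. -/
theorem eLpNorm_stepIntegral_sub [IsProbabilityMeasure P] (hB : IsPreBrownianReal B P) {n n' : ℕ}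
    {τ τ' : ℕ → ℝ≥0} (hτ : Monotone τ) (hτ' : Monotone τ') (c c' : ℕ → ℝ) :
    eLpNorm (fun ω => stepIntegral B n τ c ω - stepIntegral B n' τ' c' ω) 2 P =
      eLpNorm (fun s => stepFun n τ c s - stepFun n' τ' c' s) 2 volume := by
  have h1 := memLp_stepIntegral hB n τ c
  have h2 := memLp_stepIntegral hB n' τ' c'
  have h3 := memLp_stepFun n τ c
  have h4 := memLp_stepFun n' τ' c'
  have hA := (h1.sub h2).eLpNorm_eq_integral_rpow_norm two_ne_zero ENNReal.ofNat_ne_top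
  have hC := (h3.sub h4).eLpNorm_eq_integral_rpow_norm two_ne_zero ENNReal.ofNat_ne_top
  simp only [ENNReal.toReal_ofNat, Pi.sub_apply] at hA hC
  rw [integral_norm_sub_sq h1 h2, integral_stepIntegral_mul hB hτ hτ, integral_stepIntegral_mul hB hτ hτ',
    integral_stepIntegral_mul hB hτ' hτ', ← integral_norm_sub_sq h3 h4, ← hC] at hA
  exact hA

theorem stepFun_eq_zero {n : ℕ} {τ : ℕ → ℝ≥0} (hτ : Monotone τ) (c : ℕ → ℝ) {s : ℝ}
    (hs : s ∉ Ioc (τ 0 : ℝ) (τ n)) : stepFun n τ c s = 0 := by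
  refine Finset.sum_eq_zero fun j hj => indicator_of_notMem (fun h => hs ?_) _
  have h1 : (τ 0 : ℝ) ≤ τ j := by exact_mod_cast hτ j.zero_le
  have h2 : (τ (j + 1) : ℝ) ≤ τ n := by exact_mod_cast hτ (Finset.mem_range.1 hj)
  exact ⟨h1.trans_lt h.1, h.2.trans h2⟩

/-- The Wiener integral is unique up to null sets. -/
theorem IsWienerIntegral.ae_eq [IsProbabilityMeasure P] (hB : IsPreBrownianReal B P) {g : ℝ → ℝ}
    (hg : Continuous g) {t : ℝ≥0} {X X' : Ω → ℝ} (hX : IsWienerIntegral P B g t X)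
    (hX' : IsWienerIntegral P B g t X') : X =ᵐ[P] X' := by
  have key : ∀ η : ℝ≥0, 0 < η → eLpNorm (fun ω => X ω - X' ω) 2 P ≤ 4 * η := by
    intro η hη
    obtain ⟨n, τ, c, hτ, h0, hn, h1, h2⟩ := hX.2 η (by exact_mod_cast hη)
    obtain ⟨n', τ', c', hτ', h0', hn', h1', h2'⟩ := hX'.2 η (by exact_mod_cast hη)
    have m1 := (memLp_stepIntegral hB n τ c).aestronglyMeasurable
    have m2 := (memLp_stepIntegral hB n' τ' c').aestronglyMeasurable
    have m3 := (memLp_stepFun n τ c).aestronglyMeasurable.restrict (s := Ioc 0 (t : ℝ))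
    have m4 := (memLp_stepFun n' τ' c').aestronglyMeasurable.restrict (s := Ioc 0 (t : ℝ))
    have mg : AEStronglyMeasurable g (volume.restrict (Ioc 0 (t : ℝ))) := hg.aestronglyMeasurable
    -- Both step functions vanish outside $(0,t]$, so the isometry on the line can be restricted to
    -- the interval on which they approximate `g`.
    have h3 : eLpNorm (fun ω => stepIntegral B n τ c ω - stepIntegral B n' τ' c' ω) 2 P ≤
        η + η := by
      rw [eLpNorm_stepIntegral_sub hB hτ hτ',
        ← eLpNorm_restrict_eq_of_support_subset (s := Ioc 0 (t : ℝ))]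
      · have e : (fun s => stepFun n τ c s - stepFun n' τ' c' s) =
            (fun s => stepFun n τ c s - g s) - fun s => stepFun n' τ' c' s - g s := by
          funext s; simp
        rw [e]
        exact (eLpNorm_sub_le (m3.sub mg) (m4.sub mg) one_le_two).trans (add_le_add h1 h1')
      · intro s hs
        by_contra hst
        refine hs ?_
        change stepFun n τ c s - stepFun n' τ' c' s = 0
        rw [stepFun_eq_zero hτ c (by rw [h0, hn]; exact hst),
          stepFun_eq_zero hτ' c' (by rw [h0', hn']; exact hst), sub_zero]
    have e : (fun ω => X ω - X' ω) =
        ((fun ω => stepIntegral B n τ c ω - stepIntegral B n' τ' c' ω) -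
          fun ω => stepIntegral B n τ c ω - X ω) +
          fun ω => stepIntegral B n' τ' c' ω - X' ω := by
      funext ω; simp
    rw [e]
    refine (eLpNorm_add_le ((m1.sub m2).sub (m1.sub hX.1.1)) (m2.sub hX'.1.1) one_le_two).trans ?_
    refine (add_le_add (eLpNorm_sub_le (m1.sub m2) (m1.sub hX.1.1) one_le_two) h2').trans ?_
    refine (add_le_add (add_le_add h3 h2) le_rfl).trans_eq ?_
    ring
  have h0 : eLpNorm (fun ω => X ω - X' ω) 2 P = 0 := by
    refine le_antisymm (ENNReal.le_of_forall_pos_le_add fun η hη _ => ?_) zero_le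
    have := key (η / 4) (by positivity)
    rw [zero_add]
    refine this.trans_eq ?_
    rw [← ENNReal.coe_ofNat, ← ENNReal.coe_mul, mul_div_cancel₀ _ (by norm_num)]
  have h1 := (eLpNorm_eq_zero_iff (hX.1.1.sub hX'.1.1) two_ne_zero).1 h0
  filter_upwards [h1] with ω hω using sub_eq_zero.1 hω

end isometry

/-! ### Wiener integrals of exponentials -/

/-- The solution at time `t` of the linear equation with rate `l` and initial value zero that is
driven by the path `f`. -/
noncomputable def relax (l : ℝ) (f : ℝ → ℝ) (t : ℝ) : ℝ :=
  f t - Real.exp (-(t * l)) * f 0 - l * ∫ s in (0 : ℝ)..t, Real.exp (-(t - s) * l) * f s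

section relax

variable {l : ℝ} {f : ℝ → ℝ}

theorem continuous_relax (hf : Continuous f) : Continuous (relax l f) := by
  have e : relax l f = fun t => f t - Real.exp (-(t * l)) * f 0 -
      l * (Real.exp (-(t * l)) * ∫ s in (0 : ℝ)..t, Real.exp (s * l) * f s) := by
    funext t
    rw [relax, ← intervalIntegral.integral_const_mul (Real.exp _)]
    congr 3
    funext s
    rw [← mul_assoc, ← Real.exp_add]
    congr 2
    ring
  have h : Continuous fun t => ∫ s in (0 : ℝ)..t, Real.exp (s * l) * f s :=
    intervalIntegral.continuous_primitive
      (fun a b => (by fun_prop : Continuous fun s => Real.exp (s * l) * f s).intervalIntegrable a b) 0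
  rw [e]
  fun_prop

theorem integral_mul_exp (a b t l : ℝ) :
    ∫ s in a..b, l * Real.exp (-(t - s) * l) =
      Real.exp (-(t - b) * l) - Real.exp (-(t - a) * l) := by
  refine intervalIntegral.integral_eq_sub_of_hasDerivAt
    (f := fun s => Real.exp (-(t - s) * l)) (fun s _ => ?_)
    ((by fun_prop : Continuous _).intervalIntegrable _ _)
  have h : HasDerivAt (fun s : ℝ => -(t - s) * l) l s := by
    simpa using (((hasDerivAt_id s).const_sub t).neg).mul_const l
  simpa [mul_comm] using h.exp

/-- Only increments of `f` ending at $t$ appear here, so a Hölder bound can be inserted; the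
identity holds because $le^{-(t-s)l}$ has integral $1-e^{-tl}$. -/
theorem relax_eq (hf : Continuous f) (t : ℝ) : relax l f t = Real.exp (-(t * l)) * (f t - f 0) +
    ∫ s in (0 : ℝ)..t, l * Real.exp (-(t - s) * l) * (f t - f s) := by
  have e : ∀ s, l * Real.exp (-(t - s) * l) * (f t - f s) =
      l * Real.exp (-(t - s) * l) * f t - l * (Real.exp (-(t - s) * l) * f s) := fun s => by ring
  simp_rw [e]
  rw [intervalIntegral.integral_sub
    ((by fun_prop : Continuous _).intervalIntegrable _ _)
    ((by fun_prop : Continuous _).intervalIntegrable _ _), intervalIntegral.integral_mul_const,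
    integral_mul_exp, intervalIntegral.integral_const_mul, relax]
  simp only [sub_self, neg_zero, zero_mul, Real.exp_zero, sub_zero, neg_mul]
  ring

/-- Half of the exponential absorbs the power; the other half remains to be integrated. -/
theorem rpow_mul_exp_neg_le {γ x : ℝ} (hγ : 0 ≤ γ) (hγ' : γ ≤ 1) (hx : 0 ≤ x) :
    x ^ γ * Real.exp (-x) ≤ 2 * Real.exp (-(x / 2)) := by
  have h1 : x ^ γ ≤ 1 + x := by
    rcases le_total x 1 with h | h
    · exact (Real.rpow_le_one hx h hγ).trans (by linarith)
    · exact ((Real.rpow_le_rpow_of_exponent_le h hγ').trans_eq (Real.rpow_one x)).trans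
        (by linarith)
  have h2 : 1 + x ≤ 2 * Real.exp (x / 2) := by
    have := Real.add_one_le_exp (x / 2)
    linarith
  calc x ^ γ * Real.exp (-x) ≤ 2 * Real.exp (x / 2) * Real.exp (-x) :=
        mul_le_mul_of_nonneg_right (h1.trans h2) (Real.exp_nonneg _)
    _ = 2 * Real.exp (-(x / 2)) := by
        rw [mul_assoc, ← Real.exp_add]; congr 2; ring

/-- By scaling, $r^\gamma e^{-lr}=l^{-\gamma}(lr)^\gamma e^{-lr}\le2l^{-\gamma}e^{-lr/2}$. The
boundary term contributes $2$ to the constant. The integral contributes $4$, because $\int_0^\infty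
le^{-lr/2}dr=2$. -/
theorem abs_relax_le (hf : Continuous f) (hl : 0 < l) {γ K t : ℝ} (hγ : 0 ≤ γ) (hγ' : γ ≤ 1)
    (hK : 0 ≤ K) (ht : 0 ≤ t) (h : ∀ s ∈ Icc 0 t, |f t - f s| ≤ K * |t - s| ^ γ) :
    |relax l f t| ≤ 6 * K * l ^ (-γ) := by
  have hmul (r : ℝ) (hr : 0 ≤ r) : r ^ γ = l ^ (-γ) * (l * r) ^ γ := by
    rw [Real.mul_rpow hl.le hr, ← mul_assoc, ← Real.rpow_add hl, neg_add_cancel, Real.rpow_zero,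
      one_mul]
  have hexp (s : ℝ) (hs : s ∈ Icc 0 t) : Real.exp (-(t - s) * l) * |f t - f s| ≤
      K * l ^ (-γ) * (2 * Real.exp (-(t - s) * (l / 2))) := by
    have hts : 0 ≤ t - s := sub_nonneg.2 hs.2
    have h1 := rpow_mul_exp_neg_le hγ hγ' (mul_nonneg hl.le hts)
    calc _ ≤ Real.exp (-(t - s) * l) * (K * |t - s| ^ γ) :=
          mul_le_mul_of_nonneg_left (h s hs) (Real.exp_nonneg _)
      _ = K * l ^ (-γ) * ((l * (t - s)) ^ γ * Real.exp (-(l * (t - s)))) := by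
          rw [abs_of_nonneg hts, hmul _ hts, show -(t - s) * l = -(l * (t - s)) by ring]; ring
      _ ≤ K * l ^ (-γ) * (2 * Real.exp (-(l * (t - s) / 2))) :=
          mul_le_mul_of_nonneg_left h1 (by positivity)
      _ = _ := by congr 3; ring
  rw [relax_eq hf]
  refine (abs_add_le _ _).trans ?_
  have hA : |Real.exp (-(t * l)) * (f t - f 0)| ≤ K * l ^ (-γ) * 2 := by
    rw [abs_mul, Real.abs_exp]
    have h1 := hexp 0 ⟨le_rfl, ht⟩
    rw [sub_zero, neg_mul] at h1
    refine h1.trans (mul_le_mul_of_nonneg_left ?_ (by positivity))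
    have h2 : Real.exp (-t * (l / 2)) ≤ 1 := by
      rw [Real.exp_le_one_iff, neg_mul, neg_nonpos]
      positivity
    linarith
  have hB : |∫ s in (0 : ℝ)..t, l * Real.exp (-(t - s) * l) * (f t - f s)| ≤
      K * l ^ (-γ) * 4 := by
    rw [← Real.norm_eq_abs]
    calc _ ≤ ∫ s in (0 : ℝ)..t, K * l ^ (-γ) * 4 * (l / 2 * Real.exp (-(t - s) * (l / 2))) := by
          refine intervalIntegral.norm_integral_le_of_norm_le ht (Eventually.of_forall fun s hs => ?_)
            ((by fun_prop : Continuous _).intervalIntegrable _ _)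
          rw [norm_mul, norm_mul, Real.norm_of_nonneg hl.le, Real.norm_of_nonneg (Real.exp_nonneg _),
            Real.norm_eq_abs, mul_assoc]
          refine (mul_le_mul_of_nonneg_left (hexp s ⟨hs.1.le, hs.2⟩) hl.le).trans_eq ?_
          ring
      _ = K * l ^ (-γ) * 4 * (1 - Real.exp (-(t - 0) * (l / 2))) := by
          rw [intervalIntegral.integral_const_mul, integral_mul_exp]
          simp
      _ ≤ K * l ^ (-γ) * 4 * 1 :=
          mul_le_mul_of_nonneg_left (by linarith [Real.exp_nonneg (-(t - 0) * (l / 2))])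
            (by positivity)
      _ = _ := mul_one _
  linarith

/-- Summation by parts: Riemann–Stieltjes sums for the solution of the linear equation. -/
theorem abs_sum_sub_relax_le (hf : Continuous f) (hl : 0 < l) {t η : ℝ} (hη : 0 ≤ η) {n : ℕ}
    {τ : ℕ → ℝ} (hτ : Monotone τ) (h0 : τ 0 = 0) (hn : τ n = t)
    (h : ∀ j < n, ∀ s ∈ Icc (τ j) (τ (j + 1)), |f s - f (τ j)| ≤ η) :
    |(∑ j ∈ Finset.range n, Real.exp (-(t - τ (j + 1)) * l) * (f (τ (j + 1)) - f (τ j))) -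
      relax l f t| ≤ η := by
  set g : ℝ → ℝ := fun s => Real.exp (-(t - s) * l) with hg
  have hgc : Continuous g := by fun_prop
  have hint (a b : ℝ) : IntervalIntegrable (fun s => l * g s * f s) volume a b :=
    (by fun_prop : Continuous _).intervalIntegrable _ _
  have hint' (a b : ℝ) (c : ℝ) : IntervalIntegrable (fun s => l * g s * c) volume a b :=
    (by fun_prop : Continuous _).intervalIntegrable _ _
  -- Since $g'=lg$, replacing `f` by its left endpoint value on one interval costs at most $\eta$
  -- times the increment of `g`. These errors telescope.
  have key : ∀ m ≤ n, |(∑ j ∈ Finset.range m, g (τ (j + 1)) * (f (τ (j + 1)) - f (τ j))) -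
      (g (τ m) * f (τ m) - g 0 * f 0 - ∫ s in (0 : ℝ)..τ m, l * g s * f s)| ≤
        η * (g (τ m) - g 0) := by
    intro m
    induction m with
    | zero => intro _; simp [h0]
    | succ m ih =>
      intro hm
      have h1 := ih (by omega)
      have hle : τ m ≤ τ (m + 1) := hτ m.le_succ
      have e1 := intervalIntegral.integral_add_adjacent_intervals (hint 0 (τ m))
        (hint (τ m) (τ (m + 1)))
      have e2 : ∫ s in (τ m)..τ (m + 1), l * g s * (f s - f (τ m)) =
          (∫ s in (τ m)..τ (m + 1), l * g s * f s) - (g (τ (m + 1)) - g (τ m)) * f (τ m) := by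
        simp_rw [mul_sub]
        rw [intervalIntegral.integral_sub (hint _ _) (hint' _ _ _),
          intervalIntegral.integral_mul_const, integral_mul_exp]
      have h2 : |∫ s in (τ m)..τ (m + 1), l * g s * (f s - f (τ m))| ≤
          η * (g (τ (m + 1)) - g (τ m)) := by
        rw [← integral_mul_exp, ← intervalIntegral.integral_const_mul, ← Real.norm_eq_abs]
        refine intervalIntegral.norm_integral_le_of_norm_le hle (Eventually.of_forall fun s hs => ?_)
          ((by fun_prop : Continuous _).intervalIntegrable _ _)
        have h3 : 0 ≤ l * g s := mul_nonneg hl.le (Real.exp_nonneg _)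
        rw [norm_mul, Real.norm_of_nonneg h3, Real.norm_eq_abs, mul_comm]
        exact mul_le_mul_of_nonneg_right (h m (by omega) s ⟨hs.1.le, hs.2⟩) h3
      rw [Finset.sum_range_succ, ← e1]
      rw [e2] at h2
      rw [abs_le] at h1 h2 ⊢
      constructor <;> nlinarith [h1.1, h1.2, h2.1, h2.2]
  have hfin := key n le_rfl
  have hgt : g t = 1 := by simp [hg]
  have hg0 : g 0 = Real.exp (-(t * l)) := by simp [hg]
  have e : relax l f t = g (τ n) * f (τ n) - g 0 * f 0 - ∫ s in (0 : ℝ)..τ n, l * g s * f s := by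
    rw [hn, hgt, hg0, one_mul, relax, ← intervalIntegral.integral_const_mul]
    simp only [hg, mul_assoc]
  rw [e]
  refine hfin.trans ?_
  rw [hn, hgt]
  exact mul_le_of_le_one_right hη (by linarith [Real.exp_nonneg (-(t * l))])

end relax

theorem abs_stepFun_sub_le {n : ℕ} {τ : ℕ → ℝ≥0} (hτ : Monotone τ) {c : ℕ → ℝ} {s y η : ℝ}
    (hs : s ∈ Ioc (τ 0 : ℝ) (τ n))
    (h : ∀ j < n, s ∈ Ioc (τ j : ℝ) (τ (j + 1)) → |c j - y| ≤ η) :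
    |stepFun n τ c s - y| ≤ η := by
  have hτ' : Monotone fun j => (τ j : ℝ) := fun i j hij => by exact_mod_cast hτ hij
  have hU := hτ'.biUnion_Ico_Ioc_map_succ 0 n
  rw [← hU, mem_iUnion₂] at hs
  obtain ⟨j, hj, hjs⟩ := hs
  have e : stepFun n τ c s = c j := by
    rw [stepFun, Finset.sum_eq_single j]
    · exact indicator_of_mem hjs _
    · intro i _ hij
      refine indicator_of_notMem (fun hi => ?_) _
      exact (hτ'.pairwise_disjoint_on_Ioc_succ hij).le_bot ⟨hi, hjs⟩
    · intro h
      exact absurd (Finset.mem_range.2 hj.2) h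
  rw [e]
  exact h j hj.2 hjs

theorem abs_exp_sub_exp_le {a b : ℝ} (hab : a ≤ b) (hb : b ≤ 0) :
    |Real.exp b - Real.exp a| ≤ b - a := by
  have h1 := Real.add_one_le_exp (a - b)
  have h2 : Real.exp a = Real.exp b * Real.exp (a - b) := by rw [← Real.exp_add]; congr 1; ring
  have h3 : Real.exp b ≤ 1 := Real.exp_le_one_iff.2 hb
  rw [abs_of_nonneg (sub_nonneg.2 (Real.exp_le_exp.2 hab)), h2]
  nlinarith [Real.exp_nonneg b]

section wiener

variable {Ω : Type*} [MeasurableSpace Ω] {P : Measure Ω} {B : ℝ≥0 → Ω → ℝ}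

theorem memLp_two_of_lintegral_sq {K : Ω → ℝ≥0} (hK : AEMeasurable K P)
    (hK2 : ∫⁻ ω, (K ω : ℝ≥0∞) ^ 2 ∂P ≠ ∞) : MemLp (fun ω => (K ω : ℝ)) 2 P := by
  refine ⟨hK.coe_nnreal_real.aestronglyMeasurable, ?_⟩
  rw [eLpNorm_lt_top_iff_lintegral_rpow_enorm_lt_top two_ne_zero ENNReal.ofNat_ne_top]
  refine lt_of_le_of_lt (lintegral_mono fun ω => ?_) hK2.lt_top
  simp

/-- The Wiener integral of an exponential is given by the solution of the linear equation. -/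
theorem isWienerIntegral_relax (hB : IsBrownianReal B P) {K : Ω → ℝ≥0} (hK : AEMeasurable K P)
    (hK2 : ∫⁻ ω, (K ω : ℝ≥0∞) ^ 2 ∂P ≠ ∞) {γ T l t : ℝ} (hγ : 0 < γ) (hγ' : γ ≤ 1) (hl : 0 < l)
    (hhol : ∀ᵐ ω ∂P, ∀ s ∈ Icc 0 T, ∀ t ∈ Icc 0 T,
      |B t.toNNReal ω - B s.toNNReal ω| ≤ K ω * |t - s| ^ γ) (ht : t ∈ Icc 0 T) :
    IsWienerIntegral P B (fun s => Real.exp (-(t - s) * l)) t.toNNReal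
      fun ω => relax l (fun s => B s.toNNReal ω) t := by
  have hKL := memLp_two_of_lintegral_sq hK hK2
  -- Equidistant partitions into $n+1$ intervals. The weights are taken at right endpoints, as the
  -- summation by parts requires.
  set τ : ℕ → ℕ → ℝ≥0 := fun n j => t.toNNReal * (j / (n + 1)) with hτ
  set c : ℕ → ℕ → ℝ := fun n j => Real.exp (-(t - τ n (j + 1)) * l) with hc
  have hτr (n j : ℕ) : (τ n j : ℝ) = t * (j / (n + 1)) := by
    simp only [hτ]
    push_cast
    rw [Real.coe_toNNReal _ ht.1]
  have hmono (n : ℕ) : Monotone (τ n) := fun i j hij => by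
    simp only [hτ]
    gcongr
  have h0 (n : ℕ) : τ n 0 = 0 := by simp [hτ]
  have hn (n : ℕ) : τ n (n + 1) = t.toNNReal := by
    ext
    rw [hτr, Real.coe_toNNReal _ ht.1]
    push_cast
    field_simp
  have hmesh (n j : ℕ) : (τ n (j + 1) : ℝ) - τ n j = t / (n + 1) := by
    rw [hτr, hτr]; push_cast; field_simp; ring
  have hle (n j : ℕ) (hj : j ≤ n + 1) : (τ n j : ℝ) ≤ t := by
    have h1 : (τ n j : ℝ) ≤ τ n (n + 1) := by exact_mod_cast hmono n hj
    rwa [hn, Real.coe_toNNReal _ ht.1] at h1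
  -- The Hölder bound controls the oscillation of the path on each interval. The error is a null
  -- sequence times `K`, so convergence holds almost surely and, by the second moment of `K`, in the
  -- square mean.
  have hpath : ∀ᵐ ω ∂P, ∀ n : ℕ,
      |stepIntegral B (n + 1) (τ n) (c n) ω - relax l (fun s => B s.toNNReal ω) t| ≤
        (t / (n + 1)) ^ γ * K ω := by
    filter_upwards [hhol, hB.cont] with ω hω hcω n
    have hfc : Continuous fun s : ℝ => B s.toNNReal ω := hcω.comp continuous_real_toNNReal
    have h1 := abs_sum_sub_relax_le hfc hl (t := t) (η := (t / (n + 1)) ^ γ * K ω) (n := n + 1)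
      (τ := fun j => (τ n j : ℝ)) (mul_nonneg (Real.rpow_nonneg (div_nonneg ht.1 (by positivity)) _)
        (NNReal.coe_nonneg _)) (fun i j hij => by exact_mod_cast hmono n hij) (by simp [h0])
      (by simp only [hn]; exact Real.coe_toNNReal _ ht.1) (fun j hj s hs => ?_)
    · simpa only [Real.toNNReal_coe, stepIntegral] using h1
    · have hτ0 : 0 ≤ (τ n j : ℝ) := NNReal.coe_nonneg _
      have hs1 := hle n (j + 1) (by omega)
      have h2 := hω (τ n j) ⟨hτ0, (hle n j (by omega)).trans ht.2⟩ s
        ⟨hτ0.trans hs.1, (hs.2.trans hs1).trans ht.2⟩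
      refine h2.trans ?_
      rw [mul_comm]
      refine mul_le_mul_of_nonneg_right ?_ (NNReal.coe_nonneg _)
      refine Real.rpow_le_rpow (abs_nonneg _) ?_ hγ.le
      rw [abs_of_nonneg (sub_nonneg.2 hs.1), ← hmesh n j]
      linarith [hs.2]
  have hlim : Tendsto (fun n : ℕ => t / ((n : ℝ) + 1)) atTop (𝓝 0) := by
    have := (tendsto_one_div_add_atTop_nhds_zero_nat (𝕜 := ℝ)).const_mul t
    simpa [div_eq_mul_inv] using this
  have hlimγ : Tendsto (fun n : ℕ => (t / ((n : ℝ) + 1)) ^ γ) atTop (𝓝 0) := by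
    have := hlim.rpow_const (p := γ) (Or.inr hγ.le)
    rwa [Real.zero_rpow hγ.ne'] at this
  have hmeas : AEStronglyMeasurable (fun ω => relax l (fun s => B s.toNNReal ω) t) P := by
    refine aestronglyMeasurable_of_tendsto_ae atTop
      (f := fun n => stepIntegral B (n + 1) (τ n) (c n)) (fun n =>
        (memLp_stepIntegral hB.toIsPreBrownianReal _ _ _).aestronglyMeasurable) ?_
    filter_upwards [hpath] with ω hω
    refine tendsto_iff_dist_tendsto_zero.2
      (squeeze_zero (fun _ => dist_nonneg) (fun n => hω n) ?_)
    simpa using hlimγ.mul_const (K ω : ℝ)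
  refine ⟨?_, fun η hη => ?_⟩
  · refine hKL.of_le_mul (c := 6 * l ^ (-γ)) hmeas ?_
    filter_upwards [hhol, hB.cont] with ω hω hcω
    have hfc : Continuous fun s : ℝ => B s.toNNReal ω := hcω.comp continuous_real_toNNReal
    have h1 := abs_relax_le hfc hl hγ.le hγ' (K ω).2 ht.1
      fun s hs => hω s ⟨hs.1, hs.2.trans ht.2⟩ t ht
    rw [Real.norm_eq_abs, Real.norm_of_nonneg (NNReal.coe_nonneg _)]
    refine h1.trans_eq ?_
    rw [NNReal.val_eq_coe]
    ring
  · have hA : Tendsto (fun n : ℕ => ENNReal.ofReal ((t / (n + 1)) ^ γ) *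
        eLpNorm (fun ω => (K ω : ℝ)) 2 P) atTop (𝓝 0) := by
      have := ENNReal.Tendsto.mul_const (b := eLpNorm (fun ω => (K ω : ℝ)) 2 P)
        (ENNReal.tendsto_ofReal hlimγ) (Or.inr hKL.2.ne)
      simpa using this
    have hC : Tendsto (fun n : ℕ => (volume.restrict (Ioc 0 (t.toNNReal : ℝ))) univ ^
        ((2 : ℝ≥0∞).toReal)⁻¹ * ENNReal.ofReal (t / (n + 1) * l)) atTop (𝓝 0) := by
      have := ENNReal.Tendsto.const_mul (a := (volume.restrict (Ioc 0 (t.toNNReal : ℝ))) univ ^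
        ((2 : ℝ≥0∞).toReal)⁻¹) (ENNReal.tendsto_ofReal (hlim.mul_const l)) (Or.inr ?_)
      · simpa using this
      · exact ENNReal.rpow_ne_top_of_nonneg (by positivity) (by simp)
    obtain ⟨n, hn1, hn2⟩ := ((hA.eventually_lt_const hη).and (hC.eventually_lt_const hη)).exists
    refine ⟨n + 1, τ n, c n, hmono n, h0 n, hn n, le_trans ?_ hn2.le, le_trans ?_ hn1.le⟩
    · refine eLpNorm_le_of_ae_bound ?_
      filter_upwards [ae_restrict_mem measurableSet_Ioc] with s hs
      refine abs_stepFun_sub_le (hmono n) (by rw [h0, hn]; exact hs) fun j hj hjs => ?_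
      have h1 := hle n (j + 1) (by omega)
      have h2 := hmesh n j
      refine (abs_exp_sub_exp_le (mul_le_mul_of_nonneg_right (by linarith [hjs.2]) hl.le)
        (mul_nonpos_of_nonpos_of_nonneg (by linarith) hl.le)).trans ?_
      rw [← sub_mul]
      exact mul_le_mul_of_nonneg_right (by linarith [hjs.1]) hl.le
    · refine eLpNorm_le_mul_eLpNorm_of_ae_le_mul ?_ 2
      filter_upwards [hpath] with ω hω
      rw [Real.norm_of_nonneg (NNReal.coe_nonneg _)]
      exact hω n

end wiener

/-! ### The stochastic convolution -/

section convolution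

variable {Ω : Type*} [MeasurableSpace Ω] {P : Measure Ω} {L : ℝ} [hL : Fact (0 < L)]

/-- The Euclidean length dominates the maximum norm, for which the lattice sum is known to converge.
-/
theorem summable_len_rpow {p : ℝ} (hp : 2 < p) : Summable fun k : Mode => k.len ^ (-p) := by
  have h := (EisensteinSeries.summable_one_div_norm_rpow hp).comp_injective
    (Subtype.val_injective (p := fun k : Fin 2 → ℤ => k ≠ 0))
  refine h.of_nonneg_of_le (fun k => Real.rpow_nonneg k.len_pos.le _) fun k => ?_
  refine Real.rpow_le_rpow_of_nonpos (norm_pos_iff.2 k.2) ?_ (by linarith)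
  refine (pi_norm_le_iff_of_nonneg k.len_pos.le).2 fun i => ?_
  rw [Int.norm_eq_abs]
  refine Real.abs_le_sqrt ?_
  fin_cases i
  · exact le_add_of_nonneg_right (sq_nonneg _)
  · exact le_add_of_nonneg_left (sq_nonneg _)

/-- With $\gamma=1/2-\eta$, the summand is of order
$|k|^{2-8\gamma-2\delta}=|k|^{-2+8\eta-2\delta}$. The choice $\eta\le\delta/8$ brings it below
$|k|^{-2-\delta}$, which is summable in dimension two; $\eta\le1/4$ keeps $\gamma$ positive. -/
theorem exists_summable_weights {α : Mode → ℝ} {δ C : ℝ} (hδ : 0 < δ)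
    (hα : ∀ k : Mode, |α k| ≤ C * k.len ^ (-δ)) : ∃ γ : ℝ, 0 < γ ∧ γ < 1 / 2 ∧
      Summable fun k => eig L k * α k ^ 2 * (6 * (eig L k ^ 2) ^ (-γ)) ^ 2 := by
  have hL0 := hL.out
  obtain ⟨η, hη, hη1, hη2⟩ : ∃ η : ℝ, 0 < η ∧ η ≤ δ / 8 ∧ η ≤ 1 / 4 :=
    ⟨min (δ / 8) (1 / 4), by positivity, min_le_left _ _, min_le_right _ _⟩
  refine ⟨1 / 2 - η, by linarith, by linarith, ?_⟩
  set m : ℝ := (2 * Real.pi / L) ^ 2 with hm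
  have hm0 : 0 < m := by have := Real.pi_pos; positivity
  have he (k : Mode) : eig L k = m * k.len ^ (2 : ℝ) := by
    rw [eig, hm, Real.rpow_two]; ring
  have hsum := (summable_len_rpow (show 2 < 2 + δ by linarith)).mul_left
    (36 * C ^ 2 * m ^ (-(1 - 4 * η)))
  refine hsum.of_nonneg_of_le (fun k => ?_) fun k => ?_
  · have := eig_pos L k
    positivity
  have hk := k.len_pos
  have hk1 := one_le_len k
  have h0 := eig_pos L k
  have hα2 : α k ^ 2 ≤ C ^ 2 * k.len ^ (-(2 * δ)) := by
    have h1 := pow_le_pow_left₀ (abs_nonneg _) (hα k) 2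
    rw [sq_abs, mul_pow, ← Real.rpow_natCast (k.len ^ (-δ)), ← Real.rpow_mul hk.le] at h1
    refine h1.trans_eq ?_
    congr 2
    push_cast; ring
  have e : eig L k * (6 * (eig L k ^ 2) ^ (-(1 / 2 - η))) ^ 2 =
      36 * m ^ (-(1 - 4 * η)) * k.len ^ (-(2 - 8 * η)) := by
    have e1 : ((eig L k ^ 2) ^ (-(1 / 2 - η))) ^ 2 = eig L k ^ (-(2 - 4 * η)) := by
      rw [← Real.rpow_natCast, ← Real.rpow_natCast, ← Real.rpow_mul h0.le, ← Real.rpow_mul h0.le]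
      congr 1; push_cast; ring
    have e2 : eig L k * eig L k ^ (-(2 - 4 * η)) = eig L k ^ (-(1 - 4 * η)) := by
      nth_rewrite 1 [← Real.rpow_one (eig L k)]
      rw [← Real.rpow_add h0]; congr 1; ring
    rw [mul_pow, e1, mul_left_comm, e2, he, Real.mul_rpow hm0.le (by positivity),
      ← Real.rpow_mul hk.le, ← mul_assoc]
    congr 2
    · norm_num
    · ring
  calc eig L k * α k ^ 2 * (6 * (eig L k ^ 2) ^ (-(1 / 2 - η))) ^ 2
      = α k ^ 2 * (36 * m ^ (-(1 - 4 * η)) * k.len ^ (-(2 - 8 * η))) := by rw [← e]; ring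
    _ ≤ C ^ 2 * k.len ^ (-(2 * δ)) * (36 * m ^ (-(1 - 4 * η)) * k.len ^ (-(2 - 8 * η))) :=
        mul_le_mul_of_nonneg_right hα2 (by positivity)
    _ = 36 * C ^ 2 * m ^ (-(1 - 4 * η)) * (k.len ^ (-(2 * δ)) * k.len ^ (-(2 - 8 * η))) := by ring
    _ ≤ 36 * C ^ 2 * m ^ (-(1 - 4 * η)) * k.len ^ (-(2 + δ)) := by
        refine mul_le_mul_of_nonneg_left ?_ (by positivity)
        rw [← Real.rpow_add hk]
        exact Real.rpow_le_rpow_of_exponent_le hk1 (by linarith)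

open Classical in
/-- The stochastic convolution, mode by mode, with the value zero where the series diverges. -/
noncomputable def stochConv (L : ℝ) [Fact (0 < L)] (β : Mode → ℝ≥0 → Ω → ℝ) (α : Mode → ℝ)
    (t : ℝ) (ω : Ω) : Hs L 1 :=
  if h : IsSobolev L 1 fun k => α k * relax (eig L k ^ 2) (fun s => β k s.toNNReal ω) t then
    Hs.mk _ h else 0

/-- The stochastic convolution has continuous paths. -/
theorem isContStochConv_stochConv [IsProbabilityMeasure P] {β : Mode → ℝ≥0 → Ω → ℝ}
    (hβ : ∀ k, IsBrownianReal (β k) P) {α : Mode → ℝ} {δ C : ℝ} (hδ : 0 < δ)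
    (hα : ∀ k : Mode, |α k| ≤ C * k.len ^ (-δ)) {T : ℝ} (hT : 0 < T) :
    IsContStochConv P L β α T (stochConv L β α) := by
  obtain ⟨γ, hγ, hγ', hw⟩ := exists_summable_weights (L := L) hδ hα
  set w : Mode → ℝ := fun k => eig L k * α k ^ 2 * (6 * (eig L k ^ 2) ^ (-γ)) ^ 2 with hwdef
  have hw0 (k : Mode) : 0 ≤ w k := by
    have := eig_pos L k
    positivity
  obtain ⟨M, hM, hholder⟩ := exists_holder_brownian (P := P) hγ hγ' hT
  choose K hKm hK2 hK using fun k => hholder (β k) (hβ k)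
  -- `D` will bound the squared $\mathcal H^1$ norm for all times at once. Its expectation is finite
  -- because the second moments of the `K k` share the bound `M`.
  set D : Ω → ℝ≥0∞ := fun ω => ∑' k, ENNReal.ofReal (w k) * (K k ω : ℝ≥0∞) ^ 2 with hD
  have hDm (k : Mode) : AEMeasurable (fun ω => ENNReal.ofReal (w k) * (K k ω : ℝ≥0∞) ^ 2) P :=
    ((hKm k).coe_nnreal_ennreal.pow_const 2).const_mul _
  have hDint : ∫⁻ ω, D ω ∂P ≠ ∞ := by
    rw [hD, lintegral_tsum hDm]
    have h1 (k : Mode) : ∫⁻ ω, ENNReal.ofReal (w k) * (K k ω : ℝ≥0∞) ^ 2 ∂P ≤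
        ENNReal.ofReal (w k) * M := by
      rw [lintegral_const_mul'' _ ((hKm k).coe_nnreal_ennreal.pow_const 2)]
      exact mul_le_mul_right (hK2 k) _
    refine ne_top_of_le_ne_top ?_ (ENNReal.tsum_le_tsum h1)
    rw [ENNReal.tsum_mul_right, ← ENNReal.ofReal_tsum_of_nonneg hw0 hw]
    exact ENNReal.mul_ne_top ENNReal.ofReal_ne_top hM
  have hDfin : ∀ᵐ ω ∂P, D ω ≠ ∞ := by
    filter_upwards [ae_lt_top' (AEMeasurable.tsum hDm) hDint] with ω h using h.ne
  set z : Mode → ℝ → Ω → ℝ := fun k t ω => relax (eig L k ^ 2) (fun s => β k s.toNNReal ω) t with hz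
  have hpath : ∀ᵐ ω ∂P, D ω ≠ ∞ ∧ (Summable fun k => w k * (K k ω : ℝ) ^ 2) ∧
      D ω = ENNReal.ofReal (∑' k, w k * (K k ω : ℝ) ^ 2) ∧
      (∀ k, Continuous fun t => z k t ω) ∧
      ∀ t ∈ Icc 0 T, ∀ k, eig L k ^ (1 : ℝ) * (α k * z k t ω) ^ 2 ≤ w k * (K k ω : ℝ) ^ 2 := by
    filter_upwards [hDfin, ae_all_iff.2 hK, ae_all_iff.2 fun k => (hβ k).cont] with ω h1 h2 h3
    have e (k : Mode) : ENNReal.ofReal (w k) * (K k ω : ℝ≥0∞) ^ 2 =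
        ENNReal.ofReal (w k * (K k ω : ℝ) ^ 2) := by
      rw [ENNReal.ofReal_mul (hw0 k), ENNReal.ofReal_pow (NNReal.coe_nonneg _),
        ENNReal.ofReal_coe_nnreal]
    have hnn (k : Mode) : 0 ≤ w k * (K k ω : ℝ) ^ 2 := mul_nonneg (hw0 k) (sq_nonneg _)
    have hDe : D ω = ∑' k, ENNReal.ofReal (w k * (K k ω : ℝ) ^ 2) := tsum_congr e
    have hs : Summable fun k => w k * (K k ω : ℝ) ^ 2 := by
      have := ENNReal.summable_toReal (hDe ▸ h1)
      simpa only [ENNReal.toReal_ofReal (hnn _)] using this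
    have hfc (k : Mode) : Continuous fun s : ℝ => β k s.toNNReal ω :=
      (h3 k).comp continuous_real_toNNReal
    refine ⟨h1, hs, ?_, fun k => continuous_relax (hfc k), fun t ht k => ?_⟩
    · rw [hDe, ENNReal.ofReal_tsum_of_nonneg hnn hs]
    · have h0 := eig_pos L k
      have h4 := abs_relax_le (hfc k) (pow_pos h0 2) hγ.le (by linarith) (K k ω).2 ht.1
        fun s hs => h2 k s ⟨hs.1, hs.2.trans ht.2⟩ t ht
      have h5 := pow_le_pow_left₀ (abs_nonneg _) h4 2
      rw [sq_abs] at h5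
      rw [Real.rpow_one, mul_pow, ← mul_assoc]
      refine (mul_le_mul_of_nonneg_left h5 (by positivity)).trans_eq ?_
      simp only [hwdef, NNReal.val_eq_coe]
      ring
  have hcoeff : ∀ᵐ ω ∂P, ∀ t ∈ Icc 0 T, ∀ k,
      (stochConv L β α t ω).coeff k = α k * z k t ω := by
    filter_upwards [hpath] with ω hω t ht k
    have h : IsSobolev L 1 fun k => α k * z k t ω :=
      hω.2.1.of_nonneg_of_le (fun k => by have := eig_pos L k; positivity) (hω.2.2.2.2 t ht)
    rw [stochConv, dif_pos h]
    rfl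
  have hW (k : Mode) {t : ℝ} (ht : t ∈ Icc 0 T) :
      IsWienerIntegral P (β k) (fun s => Real.exp (-(t - s) * eig L k ^ 2)) t.toNNReal (z k t) :=
    isWienerIntegral_relax (hβ k) (hKm k) (ne_top_of_le_ne_top hM (hK2 k)) hγ (by linarith)
      (pow_pos (eig_pos L k) 2) (hK k) ht
  refine ⟨fun t ht => ?_, ?_⟩
  · have hmeas : AEStronglyMeasurable (stochConv L β α t) P := by
      refine Hs.aestronglyMeasurable_of_coeff fun k => ?_
      refine ((hW k ht).1.1.const_mul (α k)).congr ?_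
      filter_upwards [hcoeff] with ω hω using (hω t ht k).symm
    refine ⟨hmeas, fun k => z k t, fun k => hW k ht, ?_⟩
    have hint : Tendsto (fun S : Finset Mode => ∫⁻ ω,
        ‖stochConv L β α t ω - ∑ k ∈ S, (α k * z k t ω) • (Hs.basis k : Hs L 1)‖ₑ ^ (2 : ℝ) ∂P)
        atTop (𝓝 (∫⁻ _, 0 ∂P)) := by
      -- Truncation does not increase the norm of the remainder, so `D` dominates all squared
      -- remainders, and they vanish pointwise by the Fourier expansion.
      refine tendsto_lintegral_filter_of_dominated_convergence' D (Eventually.of_forall fun S => ?_)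
        (Eventually.of_forall fun S => ?_) hDint ?_
      · refine (AEStronglyMeasurable.enorm (hmeas.sub ?_)).pow_const _
        exact Finset.aestronglyMeasurable_fun_sum _ fun k _ =>
          ((hW k ht).1.1.const_mul (α k)).smul_const _
      · filter_upwards [hpath, hcoeff] with ω hω hωc
        have h1 := Hs.norm_sub_sum_basis_le (stochConv L β α t ω) S
        simp only [hωc t ht] at h1
        have h2 : ‖stochConv L β α t ω‖ ^ 2 ≤ ∑' k, w k * (K k ω : ℝ) ^ 2 := by
          rw [Hs.norm_sq_eq]
          refine (Hs.isSobolev_coeff _).tsum_le_tsum (fun k => ?_) hω.2.1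
          rw [hωc t ht]
          exact hω.2.2.2.2 t ht k
        rw [hω.2.2.1, ENNReal.rpow_two, ← ofReal_norm, ← ENNReal.ofReal_pow (norm_nonneg _)]
        exact ENNReal.ofReal_le_ofReal ((pow_le_pow_left₀ (norm_nonneg _) h1 2).trans h2)
      · filter_upwards [hcoeff] with ω hωc
        have h1 := Hs.hasSum_basis (stochConv L β α t ω)
        simp only [hωc t ht] at h1
        rw [HasSum, SummationFilter.unconditional_filter] at h1
        have h2 := (tendsto_const_nhds (x := stochConv L β α t ω)).sub h1
        rw [sub_self] at h2
        have h3 := (h2.enorm).ennrpow_const 2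
        rwa [enorm_zero, ENNReal.zero_rpow_of_pos two_pos] at h3
    rw [lintegral_zero] at hint
    have h1 := hint.ennrpow_const (1 / 2)
    rw [ENNReal.zero_rpow_of_pos (by norm_num)] at h1
    refine h1.congr fun S => ?_
    rw [eLpNorm_eq_lintegral_rpow_enorm_toReal two_ne_zero ENNReal.ofNat_ne_top,
      ENNReal.toReal_ofNat]
  · filter_upwards [hpath, hcoeff] with ω hω hωc
    refine Hs.continuousOn_of_coeff hω.2.1 (fun k => ?_) fun t ht k => ?_
    · exact (((hω.2.2.2.1 k).const_mul (α k)).continuousOn).congr fun t ht => hωc t ht k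
    · rw [hωc t ht k]
      exact hω.2.2.2.2 t ht k

/-- The stochastic convolution is unique up to null sets. -/
theorem IsStochConvAt.ae_eq [IsProbabilityMeasure P] {β : Mode → ℝ≥0 → Ω → ℝ}
    (hβ : ∀ k, IsBrownianReal (β k) P) {α : Mode → ℝ} {t : ℝ} {Z Z' : Ω → Hs L 1}
    (hZ : IsStochConvAt P L β α t Z) (hZ' : IsStochConvAt P L β α t Z') : Z =ᵐ[P] Z' := by
  obtain ⟨hm, z, hz, hlim⟩ := hZ
  obtain ⟨hm', z', hz', hlim'⟩ := hZ'
  have hzz (k : Mode) : z k =ᵐ[P] z' k :=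
    (hz k).ae_eq (hβ k).toIsPreBrownianReal (by fun_prop) (hz' k)
  -- The Wiener integrals of the two representations agree almost surely, so their partial sums
  -- cancel in the triangle inequality.
  have hle (S : Finset Mode) : eLpNorm (fun ω => Z ω - Z' ω) 2 P ≤
      eLpNorm (fun ω => Z ω - ∑ k ∈ S, (α k * z k ω) • (Hs.basis k : Hs L 1)) 2 P +
        eLpNorm (fun ω => Z' ω - ∑ k ∈ S, (α k * z' k ω) • (Hs.basis k : Hs L 1)) 2 P := by
    have hS {y : Mode → Ω → ℝ} (hy : ∀ k, AEStronglyMeasurable (y k) P) : AEStronglyMeasurable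
        (fun ω => ∑ k ∈ S, (α k * y k ω) • (Hs.basis k : Hs L 1)) P :=
      Finset.aestronglyMeasurable_fun_sum _ fun k _ => ((hy k).const_mul (α k)).smul_const _
    refine le_trans (le_of_eq ?_) (eLpNorm_sub_le (hm.sub (hS fun k => (hz k).1.1))
      (hm'.sub (hS fun k => (hz' k).1.1)) one_le_two)
    refine eLpNorm_congr_ae ?_
    filter_upwards [ae_all_iff.2 hzz] with ω hω
    simp [hω]
  have h0 : eLpNorm (fun ω => Z ω - Z' ω) 2 P = 0 := by
    refine le_antisymm ?_ zero_le
    have := hlim.add hlim'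
    rw [add_zero] at this
    exact ge_of_tendsto' this hle
  have h1 := (eLpNorm_eq_zero_iff (hm.sub hm') two_ne_zero).1 h0
  filter_upwards [h1] with ω hω using sub_eq_zero.1 hω

end convolution

/-! ### Measurability of paths and proof of the theorem -/

/-- A random continuous path is measurable as soon as all its values are. -/
theorem aestronglyMeasurable_of_eval {Ω E : Type*} [MeasurableSpace Ω] {P : Measure Ω}
    [NormedAddCommGroup E] [NormedSpace ℝ E] {f : Ω → C(unitInterval, E)}
    (hf : ∀ θ, AEStronglyMeasurable (fun ω => f ω θ) P) : AEStronglyMeasurable f P := by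
  -- A Bernstein polynomial depends on finitely many values of the path and converges uniformly to
  -- it. This is the reason for rescaling time to the unit interval.
  refine aestronglyMeasurable_of_tendsto_ae atTop
    (f := fun n ω => bernsteinApproximation n (f ω)) (fun n => ?_)
    (Eventually.of_forall fun ω => bernsteinApproximation_uniform (f ω))
  unfold bernsteinApproximation
  refine Finset.aestronglyMeasurable_fun_sum _ fun k _ => ?_
  have hc : Continuous fun x : E => bernstein n k • ContinuousMap.const unitInterval x := by
    refine LipschitzWith.continuous (K := ‖bernstein n k‖₊)
      (LipschitzWith.of_dist_le_mul fun x y => ?_)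
    refine (ContinuousMap.dist_le (by positivity)).2 fun θ => ?_
    change dist (bernstein n k θ • x) (bernstein n k θ • y) ≤ _
    rw [dist_smul₀]
    exact mul_le_mul_of_nonneg_right ((bernstein n k).norm_coe_le_norm θ) dist_nonneg
  exact hc.comp_aestronglyMeasurable (hf _)

/-- Processes with continuous paths which are versions of each other are indistinguishable. -/
theorem ae_eqOn_of_forall_ae_eq {Ω E : Type*} [MeasurableSpace Ω] {P : Measure Ω}
    [TopologicalSpace E] [T2Space E] {s : Set ℝ} {X Y : ℝ → Ω → E}
    (hX : ∀ᵐ ω ∂P, ContinuousOn (fun t => X t ω) s)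
    (hY : ∀ᵐ ω ∂P, ContinuousOn (fun t => Y t ω) s)
    (h : ∀ t ∈ s, ∀ᵐ ω ∂P, X t ω = Y t ω) : ∀ᵐ ω ∂P, ∀ t ∈ s, X t ω = Y t ω := by
  obtain ⟨d, hdc, hd⟩ := TopologicalSpace.exists_countable_dense s
  have h1 : ∀ᵐ ω ∂P, ∀ t ∈ d, X t ω = Y t ω := (ae_ball_iff hdc).2 fun t _ => h t t.2
  filter_upwards [hX, hY, h1] with ω hXω hYω hω t ht
  have := Continuous.ext_on hd hXω.domRestrict hYω.domRestrict fun t ht => hω t ht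
  exact congrFun this ⟨t, ht⟩

end SurfaceGrowth

theorem mainTheorem2 {Ω : Type*} [MeasurableSpace Ω] (P : Measure Ω) [IsProbabilityMeasure P]
    (L : ℝ) [Fact (0 < L)] (κ σ : ℝ) (hκ : κ = 1 ∨ κ = -1)
    (β : Mode → ℝ≥0 → Ω → ℝ) (hβ : IsCylindricalWiener P β)
    (α : ℝ → Mode → ℝ) (δ : ℝ → ℝ) (hα : IsNoiseRegularization α δ)
    (ε : ℝ) (hε : 0 < ε) (u₀ : Hs L 1) (T : ℝ) (hT : 0 < T) :
    -- the stochastic convolution has a version with continuous paths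
    (∃ Z : ℝ → Ω → Hs L 1, IsContStochConv P L β (α ε) T Z) ∧
    -- the variation of constants map is a well-defined self-map of the space of continuous paths
    (∀ v : ℝ → Hs L 1, ContinuousOn v (Set.Icc 0 T) →
      (∀ t ∈ Set.Icc 0 T, IntervalIntegrable (driftIntegrand v t) volume 0 t) ∧
      ∀ z : ℝ → Hs L 1, ContinuousOn z (Set.Icc 0 T) →
        ContinuousOn (fun t => varConst κ σ u₀ v (z t) t) (Set.Icc 0 T)) ∧
    -- existence, with strongly measurable values and with all paths continuous
    ∃ u : ℝ → Ω → Hs L 1, IsMildSolution P L κ σ β (α ε) u₀ T u ∧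
      (∀ t ∈ Set.Icc 0 T, StronglyMeasurable (u t)) ∧
      (∀ ω, ContinuousOn (fun t => u t ω) (Set.Icc 0 T)) ∧
      -- uniqueness up to indistinguishability
      (∀ u' : ℝ → Ω → Hs L 1, IsMildSolution P L κ σ β (α ε) u₀ T u' →
        ∀ᵐ ω ∂P, ∀ t ∈ Set.Icc 0 T, u' t ω = u t ω) ∧
      -- almost every path is the unique fixed point of the variation of constants map
      ∀ Z : ℝ → Ω → Hs L 1, IsContStochConv P L β (α ε) T Z →
        ∀ᵐ ω ∂P,
          (∀ t ∈ Set.Icc 0 T, u t ω = varConst κ σ u₀ (fun s => u s ω) (Z t ω) t) ∧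
          ∀ v : ℝ → Hs L 1, ContinuousOn v (Set.Icc 0 T) →
            (∀ t ∈ Set.Icc 0 T, v t = varConst κ σ u₀ v (Z t ω) t) →
            ∀ t ∈ Set.Icc 0 T, v t = u t ω := by
  obtain ⟨C, hC⟩ := hα.decay ε hε
  set Z := stochConv L β (α ε) with hZdef
  have hZ : IsContStochConv P L β (α ε) T Z :=
    isContStochConv_stochConv hβ.1 (hα.delta_pos ε hε) hC hT
  have hunique {t : ℝ} {Z₁ Z₂ : Ω → Hs L 1} (h₁ : IsStochConvAt P L β (α ε) t Z₁)
      (h₂ : IsStochConvAt P L β (α ε) t Z₂) : Z₁ =ᵐ[P] Z₂ := h₁.ae_eq hβ.1 h₂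
  have hκ' : |κ| ≤ 1 := by rcases hκ with rfl | rfl <;> simp
  refine ⟨⟨Z, hZ⟩, fun v hv => ⟨fun t ht => intervalIntegrable_driftIntegrand hv ht,
    fun z hz => continuousOn_varConst hT.le hv hz⟩, ?_⟩
  obtain ⟨S, hS, hsol⟩ := exists_solution_map hT hκ' σ u₀
  -- The zero path is the default on the null set where the path of `Z` is not continuous.
  set W : Ω → C(unitInterval, Hs L 1) := fun ω =>
    ContinuousMap.mkD (fun θ : unitInterval => Z (T * θ) ω) 0 with hW
  have hWZ : ∀ᵐ ω ∂P, ∀ θ : unitInterval, W ω θ = Z (T * θ) ω := by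
    filter_upwards [hZ.2] with ω hω θ
    exact ContinuousMap.mkD_apply_of_continuous
      (hω.comp_continuous (by fun_prop) (mul_mem_Icc hT))
  have hWm : AEStronglyMeasurable W P := aestronglyMeasurable_of_eval fun θ =>
    ((hZ.1 _ (mul_mem_Icc hT θ)).1).congr (by filter_upwards [hWZ] with ω hω using (hω θ).symm)
  -- With a strongly measurable version of the forcing, the solution has strongly measurable values
  -- and every path is continuous, without exceptional set.
  set Y := hWm.mk W with hY
  have hYZ : ∀ᵐ ω ∂P, ∀ t ∈ Icc 0 T, rescale T (Y ω) t = Z t ω := by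
    filter_upwards [hWZ, hWm.ae_eq_mk] with ω h1 h2 t ht
    obtain ⟨θ, rfl⟩ := exists_unitInterval_eq hT ht
    rw [rescale_mul hT, ← h1, h2]
  set u : ℝ → Ω → Hs L 1 := fun t ω => rescale T (S (Y ω)) t with hu
  have hucont (ω : Ω) : ContinuousOn (fun t => u t ω) (Icc 0 T) :=
    (continuous_rescale _).continuousOn
  have humeas (t : ℝ) : StronglyMeasurable (u t) :=
    ((continuous_eval_const _).comp hS).comp_stronglyMeasurable
      hWm.stronglyMeasurable_mk
  -- The exceptional null set is independent of `v`, so the statement may later be applied to random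
  -- paths.
  have hfix : ∀ᵐ ω ∂P, ∀ v : ℝ → Hs L 1, ContinuousOn v (Icc 0 T) →
      ((∀ t ∈ Icc 0 T, v t = varConst κ σ u₀ v (Z t ω) t) ↔ ∀ t ∈ Icc 0 T, v t = u t ω) := by
    filter_upwards [hYZ] with ω hω v hv
    rw [← hsol (Y ω) v hv]
    exact forall₂_congr fun t ht => by rw [hω t ht]
  have hufix : ∀ᵐ ω ∂P, ∀ t ∈ Icc 0 T, u t ω = varConst κ σ u₀ (fun s => u s ω) (Z t ω) t := by
    filter_upwards [hfix] with ω hω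
    exact (hω _ (hucont ω)).2 fun _ _ => rfl
  refine ⟨u, ⟨fun t _ => (humeas t).aestronglyMeasurable, Eventually.of_forall hucont,
    fun t ht => ⟨Z t, hZ.1 t ht, ?_⟩⟩, fun t _ => humeas t, hucont, fun u' hu' => ?_,
    fun Z' hZ' => ?_⟩
  · filter_upwards [hufix] with ω hω using hω t ht
  -- The equation for `u'` holds outside a null set depending on $t$, with a version of the
  -- convolution depending on $t$. Uniqueness of the convolution and continuity of both sides give
  -- one null set for all times.
  · have h1 : ∀ᵐ ω ∂P, ∀ t ∈ Icc 0 T,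
        u' t ω = varConst κ σ u₀ (fun s => u' s ω) (Z t ω) t := by
      refine ae_eqOn_of_forall_ae_eq hu'.continuousOn ?_ fun t ht => ?_
      · filter_upwards [hu'.continuousOn, hZ.2] with ω h1 h2
        exact continuousOn_varConst hT.le h1 h2
      · obtain ⟨Z₁, hZ₁, h⟩ := hu'.eq_varConst t ht
        filter_upwards [h, hunique hZ₁ (hZ.1 t ht)] with ω h1 h2
        rw [h1, h2]
    filter_upwards [h1, hfix, hu'.continuousOn] with ω h2 h3 h4
    exact (h3 _ h4).1 h2
  · have h1 : ∀ᵐ ω ∂P, ∀ t ∈ Icc 0 T, Z' t ω = Z t ω :=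
      ae_eqOn_of_forall_ae_eq hZ'.2 hZ.2 fun t ht => hunique (hZ'.1 t ht) (hZ.1 t ht)
    filter_upwards [h1, hfix, hufix] with ω h2 h3 h4
    refine ⟨fun t ht => by rw [h2 t ht]; exact h4 t ht, fun v hv h => ?_⟩
    exact (h3 v hv).1 fun t ht => by rw [← h2 t ht]; exact h t ht
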